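/- \textbf{Setting.} Let $\mathcal X$ be a non-empty totally ordered set. A \emph{consensus function} is a function $f:\mathcal X^n\to Y$ (for instance $Y=\mathbb R$) such that for every $x\in\mathcal X^n$ and every $i$ there are $a,b\in\mathcal X$ such that replacing $x_i$ by $a$ or by $b$ gives different values of $f$. It is \emph{locally-sensitive} if for each permutation $\sigma$ of $\{1,\dots,n\}$ there is $x\in\mathcal X^n$ with $x_{\sigma(i)}\le x_{\sigma(j)}$ for all $i<j$, such that for every $i$ there are $a\ne b$ in $\mathcal X$ with $a,b\le x_{\sigma(j)}$ for all $j>i$ and $x_{\sigma(j)}\le a,b$ for all $j<i$, for which replacing $x_{\sigma(i)}$ by $a$ or by $b$ gives different values of $f$. It is \emph{extractive} if (regarding $\mathcal X$ as a subset of $Y$) for every $x$ one has $f(x)=x_j$ for some $j$. \textbf{Algorithms.} The $n$ nodes of a connected undirected simple graph $G$ on $\{1,\dots,n\}$ carry pairwise distinct identifiers (UIDs) from a totally ordered set. All nodes execute the same local algorithm, a possibly nondeterministic input/output automaton, which may depend on $n$, $f$ and the set of UIDs. Initially node $i$ knows its UID, its initial value $x_i\in\mathcal X$, and the UIDs of its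 neighbours; its state consists of a control state and a finite list of known UIDs and values. Nodes act asynchronously and send messages to individual neighbours; a message carries a tag and a list of UIDs and values. In a \emph{fair execution} no locally controlled action stays enabled forever without being performed, and every message is eventually delivered (first-in first-out on each directed link). A node may stop irrevocably with an output. An algorithm \emph{solves} the consensus problem for $f$ on a class $\mathcal G$ of graphs if for all $G\in\mathcal G$ and $x\in\mathcal X^n$, in every fair execution all nodes eventually stop with output $f(x)$. It is \emph{comparison-based} if UIDs and initial values are only stored, copied, sent and compared: in order-equivalent situations (same control state, same tag and port of the received message, and lists of known data in which UIDs compare with UIDs, and values with values, in the same way) the same transitions, including the generation of messages, are possible up to replacing each datum by the corresponding one, and the decision to stop is the same; the output of a stopped node may be any function of its state. \textbf{Message complexity.} Let $\mathcal G_s$ be the set of connected graphs on $\{1,\dots,n\}$ with $|E|<n\log n$, and let $\mathcal A_c$ be the set of comparison-based algorithms that solve the consensus problem for $f$ on $\mathcal G_s$. Put $$\mathrm{MC}(f,\mathcal G_s)_{|\mathcal A=\mathcal A_c}=\inf_{a\in\mathcal A_c}\ \sup_{G\in\mathcal G_s}\ \sup_{x\in\mathcal X^n}\ \sup_{\alpha}\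 M(a,x,\alpha,G),$$ where $\alpha$ ranges over the fair executions of $a$ on $G$ with initial values $x$, $M(a,x,\alpha,G)$ is the number of messages sent until all nodes have stopped with output $f(x)$, and $\inf\emptyset=\infty$. \textbf{Lemma.} If $f$ is a locally-sensitive or extractive consensus function, then $\mathrm{MC}(f,\mathcal G_s)_{|\mathcal A=\mathcal A_c}\in\Omega(n\log n)$; that is, there are constants $C>0$ and $N$ such that for all $n\ge N$ and every locally-sensitive or extractive consensus function $f$ of $n$ arguments, for all choices of the set of initial values and of the UIDs, $\mathrm{MC}(f,\mathcal G_s)_{|\mathcal A=\mathcal A_c}\ge C\,n\log n$. -/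

import Mathlib

open scoped ENNReal

universe u₁ u₂ u₃ v

/-! ### Consensus functions -/

section ConsensusFunctions

variable {n : ℕ} {X : Type u₁} {Y : Type u₂}

/-- A function of `n` initial values that depends on all its arguments: at every point and for
every coordinate, two choices of that coordinate give different results. -/
def IsConsensusFunction (f : (Fin n → X) → Y) : Prop :=
  ∀ (x : Fin n → X) (i : Fin n), ∃ a b : X,
    f (Function.update x i a) ≠ f (Function.update x i b)

/-- A consensus function that is sensitive to perturbations that preserve the order: for every
permutation `σ` there is a point `x`, ordered according to `σ`, at which every single coordinate
can take two values that keep its place in the order and give different results. -/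
def IsLocallySensitive [LinearOrder X] (f : (Fin n → X) → Y) : Prop :=
  IsConsensusFunction f ∧
    ∀ σ : Equiv.Perm (Fin n), ∃ x : Fin n → X,
      (∀ i j, i < j → x (σ i) ≤ x (σ j)) ∧
      ∀ i, ∃ a b : X, a ≠ b ∧
        (∀ j, i < j → a ≤ x (σ j) ∧ b ≤ x (σ j)) ∧
        (∀ j, j < i → x (σ j) ≤ a ∧ x (σ j) ≤ b) ∧
        f (Function.update x (σ i) a) ≠ f (Function.update x (σ i) b)

/-- A consensus function whose result is always one of the initial values. The injection `e`
regards `X` as a subset of the codomain `Y` (the identity if `Y = X`, the inclusion if `X` is a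
set of reals and `Y = ℝ`). -/
def IsExtractive (f : (Fin n → X) → Y) : Prop :=
  IsConsensusFunction f ∧ ∃ e : X ↪ Y, ∀ x, ∃ j, f x = e (x j)

end ConsensusFunctions

/-! ### Distributed algorithms -/

/-- A message: a tag, which is free of initial data, and a list of data (UIDs and values). -/
structure Message (Tag : Type v) (D : Type u₁) where
  tag : Tag
  data : List D

/-- The result of one transition of a node: the new control state, the new memory, and, for every
port, the messages that are sent through it (in this order). -/
structure Outcome (Ctrl Tag : Type v) (D : Type u₁) where
  ctrl : Ctrl
  mem : List D
  sends : ℕ → List (Message Tag D)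

/-- What a node can react to: its own turn to perform the locally controlled action number `k`,
or the arrival, at port `p`, of a message with tag `τ`. -/
inductive Trigger (Tag : Type v) : Type v
  | act (k : ℕ) : Trigger Tag
  | receive (p : ℕ) (τ : Tag) : Trigger Tag

/-- The local algorithm that every node executes: a (possibly nondeterministic) input/output
automaton. The state of a node is a control state together with a memory, a list of UIDs (in `U`)
and initial values (in `X`). `step s c m d` is the set of possible outcomes when trigger `s` occurs
in control state `c` with memory `m`, where `d` is the list of data of the received message (and
`d = []` for a locally controlled action). A locally controlled action is enabled if it has an
outcome; receptions are always enabled. `output` tells whether the node has stopped in that state,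
and with which result. -/
structure Algorithm (U : Type u₁) (X : Type u₂) (Y : Type u₃) where
  Ctrl : Type v
  Tag : Type v
  start : Ctrl
  step : Trigger Tag → Ctrl → List (U ⊕ X) → List (U ⊕ X) → Set (Outcome Ctrl Tag (U ⊕ X))
  receive_enabled : ∀ p τ c m d, (step (Trigger.receive p τ) c m d).Nonempty
  output : Ctrl → List (U ⊕ X) → Option Y

/-- Order-equivalence of two lists of data: position by position they hold data of the same kind
(UID or value), and any two positions compare in the same way in both lists. On `U ⊕ X` the order
compares UIDs with UIDs and values with values. -/
def OrderEquivalent {U : Type u₁} {X : Type u₂} [LinearOrder U] [LinearOrder X]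
    (l l' : List (U ⊕ X)) : Prop :=
  l.length = l'.length ∧
    (∀ p ∈ l.zip l', p.1.isLeft = p.2.isLeft) ∧
    ∀ p ∈ l.zip l', ∀ q ∈ l.zip l', (p.1 < q.1 ↔ p.2 < q.2)

/-- Two outcomes agree except that every datum occurring in the first is the entry of `l` at some
position, and is replaced in the second by the entry of `l'` at that position. -/
def Outcome.Corresponds {Ctrl Tag : Type v} {D : Type u₁} (l l' : List D)
    (o o' : Outcome Ctrl Tag D) : Prop :=
  o.ctrl = o'.ctrl ∧
    List.Forall₂ (fun a b => (a, b) ∈ l.zip l') o.mem o'.mem ∧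
    ∀ p, List.Forall₂
      (fun (μ μ' : Message Tag D) =>
        μ.tag = μ'.tag ∧ List.Forall₂ (fun a b => (a, b) ∈ l.zip l') μ.data μ'.data)
      (o.sends p) (o'.sends p)

namespace Algorithm

variable {U : Type u₁} {X : Type u₂} {Y : Type u₃}

/-- Comparison-based algorithms: UIDs and initial values are only stored, copied, sent and
compared. Whatever a node can do with the data it knows, it can also do with order-equivalent data,
with each datum replaced by the corresponding one (for `m = m'` and `d = d'` this says in particular
that every datum stored or sent is one of those known). The decision to stop depends only on the
order of the known data as well; the result that is then returned may depend on their values. -/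
def IsComparisonBased [LinearOrder U] [LinearOrder X]
    (A : Algorithm.{u₁, u₂, u₃, v} U X Y) : Prop :=
  (∀ s c m d m' d', m.length = m'.length → OrderEquivalent (m ++ d) (m' ++ d') →
    ∀ o ∈ A.step s c m d, ∃ o' ∈ A.step s c m' d',
      Outcome.Corresponds (m ++ d) (m' ++ d') o o') ∧
  ∀ c m m', OrderEquivalent m m' → ((A.output c m).isSome ↔ (A.output c m').isSome)

end Algorithm

/-! ### Executions on a network -/

section Network

variable {n : ℕ} {U : Type u₁} [LinearOrder U]

open scoped Classical in
/-- The port by which node `i` addresses its neighbour `j`: the neighbours of `i` are numbered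
`0, 1, 2, …` in the order of their UIDs. -/
noncomputable def port (uid : Fin n ↪ U) (G : SimpleGraph (Fin n)) (i j : Fin n) : ℕ :=
  (Finset.univ.filter fun k => G.Adj i k ∧ uid k < uid j).card

open scoped Classical in
/-- The UIDs of the neighbours of node `i`, in increasing order. -/
noncomputable def neighbourUids (uid : Fin n ↪ U) (G : SimpleGraph (Fin n)) (i : Fin n) : List U :=
  ((Finset.univ.filter fun k => G.Adj i k).map uid).sort (· ≤ ·)

end Network

/-- A global configuration: the state of each node, the queue of undelivered messages from each
node to each other node (oldest first), and the number of messages sent so far. -/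
structure Config (n : ℕ) (Ctrl Tag : Type v) (D : Type u₁) where
  ctrl : Fin n → Ctrl
  mem : Fin n → List D
  chan : Fin n → Fin n → List (Message Tag D)
  sent : ℕ

/-- The events of an execution: nothing happens, node `i` performs its locally controlled action
`k`, or the oldest message in transit from `i` to `j` is delivered. -/
inductive Event (n : ℕ)
  | idle : Event n
  | act (i : Fin n) (k : ℕ) : Event n
  | deliver (i j : Fin n) : Event n

namespace Config

variable {n : ℕ} {Ctrl Tag : Type v} {D : Type u₂} {U : Type u₁} [LinearOrder U]

open scoped Classical in
/-- Node `i` enters a new state and sends the messages prescribed by the outcome `o`, each of which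
counts once. -/
noncomputable def perform (uid : Fin n ↪ U) (G : SimpleGraph (Fin n))
    (c : Config n Ctrl Tag D) (i : Fin n) (o : Outcome Ctrl Tag D) : Config n Ctrl Tag D where
  ctrl := Function.update c.ctrl i o.ctrl
  mem := Function.update c.mem i o.mem
  chan := fun a b =>
    if a = i ∧ G.Adj a b then c.chan a b ++ o.sends (port uid G a b) else c.chan a b
  sent := c.sent + ∑ b with G.Adj i b, (o.sends (port uid G i b)).length

/-- The oldest message from `i` to `j` is removed from its queue. -/
def dequeue (c : Config n Ctrl Tag D) (i j : Fin n) : Config n Ctrl Tag D :=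
  { c with chan := fun a b => if a = i ∧ b = j then (c.chan a b).tail else c.chan a b }

end Config

namespace Algorithm

variable {n : ℕ} {U : Type u₁} [LinearOrder U] {X : Type u₂} {Y : Type u₃}

/-- The configurations of a network of `n` nodes that execute `A`. -/
abbrev Configuration (A : Algorithm.{u₁, u₂, u₃, v} U X Y) (n : ℕ) :=
  Config n A.Ctrl A.Tag (U ⊕ X)

/-- The result with which node `i` has stopped, if it has. -/
def decision (A : Algorithm.{u₁, u₂, u₃, v} U X Y) (c : A.Configuration n) (i : Fin n) : Option Y :=
  A.output (c.ctrl i) (c.mem i)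

/-- At the start a node knows its own UID, its own initial value, and the UIDs of its neighbours. -/
noncomputable def initial (A : Algorithm.{u₁, u₂, u₃, v} U X Y) (uid : Fin n ↪ U)
    (G : SimpleGraph (Fin n)) (x : Fin n → X) : A.Configuration n where
  ctrl := fun _ => A.start
  mem := fun i => Sum.inl (uid i) :: Sum.inr (x i) :: (neighbourUids uid G i).map Sum.inl
  chan := fun _ _ => []
  sent := 0

/-- Node `i` has not stopped and its locally controlled action `k` is enabled. -/
def Enabled (A : Algorithm.{u₁, u₂, u₃, v} U X Y) (c : A.Configuration n) (i : Fin n) (k : ℕ) :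
    Prop :=
  A.decision c i = none ∧ (A.step (Trigger.act k) (c.ctrl i) (c.mem i) []).Nonempty

/-- One step of the network. A node that has stopped performs no actions, and messages that reach it
are discarded. -/
inductive Step (A : Algorithm.{u₁, u₂, u₃, v} U X Y) (uid : Fin n ↪ U) (G : SimpleGraph (Fin n)) :
    A.Configuration n → Event n → A.Configuration n → Prop
  | idle (c) : Step A uid G c Event.idle c
  | act (c i k o) : A.decision c i = none →
      o ∈ A.step (Trigger.act k) (c.ctrl i) (c.mem i) [] →
      Step A uid G c (Event.act i k) (c.perform uid G i o)
  | deliver (c i j μ o) : (c.chan i j).head? = some μ → A.decision c j = none →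
      o ∈ A.step (Trigger.receive (port uid G j i) μ.tag) (c.ctrl j) (c.mem j) μ.data →
      Step A uid G c (Event.deliver i j) ((c.dequeue i j).perform uid G j o)
  | discard (c i j) : c.chan i j ≠ [] → A.decision c j ≠ none →
      Step A uid G c (Event.deliver i j) (c.dequeue i j)

/-- The fair (asynchronous) executions of `A` on the network `G` with initial values `x`: no action
stays enabled forever without being performed, and every message is eventually delivered. -/
structure FairExecution (A : Algorithm.{u₁, u₂, u₃, v} U X Y) (uid : Fin n ↪ U)
    (G : SimpleGraph (Fin n)) (x : Fin n → X) where
  config : ℕ → A.Configuration n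
  event : ℕ → Event n
  config_zero : config 0 = A.initial uid G x
  config_succ : ∀ t, A.Step uid G (config t) (event t) (config (t + 1))
  fair_act : ∀ i k t, ∃ t' ≥ t, event t' = Event.act i k ∨ ¬ A.Enabled (config t') i k
  fair_deliver : ∀ i j t, ∃ t' ≥ t, event t' = Event.deliver i j ∨ (config t').chan i j = []

/-- The times at which all nodes have stopped with the correct value of `f`. -/
def FairExecution.completed {A : Algorithm.{u₁, u₂, u₃, v} U X Y} {uid : Fin n ↪ U}
    {G : SimpleGraph (Fin n)} {x : Fin n → X} (α : A.FairExecution uid G x)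
    (f : (Fin n → X) → Y) : Set ℕ :=
  {t | ∀ i, A.decision (α.config t) i = some (f x)}

/-- The number of messages sent until, for the first time, all nodes have stopped with the correct
value of `f`. -/
noncomputable def FairExecution.messages {A : Algorithm.{u₁, u₂, u₃, v} U X Y} {uid : Fin n ↪ U}
    {G : SimpleGraph (Fin n)} {x : Fin n → X} (α : A.FairExecution uid G x)
    (f : (Fin n → X) → Y) : ℕ :=
  (α.config (sInf (α.completed f))).sent

/-- `A` computes `f` on all networks in the class `𝒢`: in every fair execution, from any initial
values, all nodes eventually stop with the value of `f`. -/
def Solves (A : Algorithm.{u₁, u₂, u₃, v} U X Y) (uid : Fin n ↪ U)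
    (𝒢 : Set (SimpleGraph (Fin n))) (f : (Fin n → X) → Y) : Prop :=
  ∀ G ∈ 𝒢, ∀ (x : Fin n → X) (α : A.FairExecution uid G x), (α.completed f).Nonempty

end Algorithm

/-! ### Message complexity -/

/-- Sparse networks: connected graphs on `n` nodes with fewer than `n log n` edges. -/
def sparseGraphs (n : ℕ) : Set (SimpleGraph (Fin n)) :=
  {G | G.Connected ∧ (G.edgeSet.ncard : ℝ) < n * Real.log n}

/-- The message complexity of computing `f` on the class `𝒢` of networks, minimized over the
comparison-based algorithms that solve the problem (with the infimum of the empty set equal to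
`⊤`): the worst-case number of messages over networks, initial values and fair executions. -/
noncomputable def comparisonMessageComplexity {n : ℕ} {U : Type u₁} [LinearOrder U] {X : Type u₂}
    [LinearOrder X] {Y : Type u₃} (uid : Fin n ↪ U) (f : (Fin n → X) → Y)
    (𝒢 : Set (SimpleGraph (Fin n))) : ℕ∞ :=
  ⨅ (A : Algorithm.{u₁, u₂, u₃, v} U X Y) (_ : A.IsComparisonBased) (_ : A.Solves uid 𝒢 f),
    ⨆ (G : SimpleGraph (Fin n)) (_ : G ∈ 𝒢) (x : Fin n → X) (α : A.FairExecution uid G x),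
      (α.messages f : ℕ∞)

/-! The hard networks are rings. Let the nodes work in phases: in each phase all nodes try the same
action, or a reception at the same port, and nondeterminism is resolved alike in order-equivalent
situations (`exists_equivariantChoice`). Call a phase active if some message is sent in it. After k
active phases the state of a node depends, up to replacement of data by corresponding data, only on
the order pattern of the UIDs and values within distance k + 1 (`localRel_phase`). So in the next
active phase, a message sent by one node is matched by a message from every node whose window of
radius k + 1 has the same pattern. If every window of radius w ≤ K has at least n / (16 w) copies,
then K active phases cost at least (n / 16)(1 + 1/2 + ... + 1/K) messages (`sum_le_sent_phase`).
With K of order √n this is at least n log n / 64.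

Fewer than K active phases cannot suffice if some x' agrees with x within distance K of a node while
f x' ≠ f x. Asynchrony allows the nodes far from that node to be frozen in an execution from x'; the
node then cannot tell x' from x (`localRel_eq_phase`) and stops with f x, irrevocably.

It remains to find such rings and inputs. Order position p by a p mod m, where a / m is the reduced
form of an approximation of √2 with denominator n. Passing from p to another position shifts all
keys of a window by the same constant modulo m, and the order pattern is kept as long as no key
wraps around. Since √2 is badly approximable, the largest and the smallest key of a window of radius
w differ by at most m - m / (16 w), which leaves enough shifts (`OrderedBy.repetitive`). A
locally-sensitive function has an input ordered like the UIDs that can be perturbed at one node; for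
an extractive function a constant input is compared with one that takes two values, each on a long
arc (`exists_repetitive_input`). -/

set_option linter.unusedSectionVars false

/-! ### Order-equivalence and equivariant choices -/

section OrderEquivalence

variable {U : Type u₁} {X : Type u₂} [LinearOrder U] [LinearOrder X]

/-- A relation between data that respects kinds and comparisons. -/
structure OrderRel (W : U ⊕ X → U ⊕ X → Prop) : Prop where
  isLeft_eq : ∀ a b, W a b → a.isLeft = b.isLeft
  lt_iff : ∀ a b, W a b → ∀ a' b', W a' b' → (a < a' ↔ b < b')

theorem OrderRel.eq : OrderRel (Eq : U ⊕ X → U ⊕ X → Prop) :=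
  ⟨by rintro _ _ rfl; rfl, by rintro _ _ rfl _ _ rfl; rfl⟩

theorem Sum.eq_of_not_lt {a b : U ⊕ X} (h : a.isLeft = b.isLeft) (h1 : ¬ a < b) (h2 : ¬ b < a) :
    a = b := by
  rcases a with a | a <;> rcases b with b | b <;> simp at h h1 h2 ⊢ <;> exact le_antisymm h2 h1

/-- Equality of data of the same kind is the failure of both strict comparisons, so a relation that
respects comparisons also respects equality. -/
theorem OrderRel.right_unique {W : U ⊕ X → U ⊕ X → Prop} (hW : OrderRel W) {a b b' : U ⊕ X}
    (h : W a b) (h' : W a b') : b = b' := by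
  refine Sum.eq_of_not_lt ((hW.isLeft_eq _ _ h).symm.trans (hW.isLeft_eq _ _ h')) ?_ ?_
  · rw [← hW.lt_iff _ _ h _ _ h']; exact lt_irrefl a
  · rw [← hW.lt_iff _ _ h' _ _ h]; exact lt_irrefl a

theorem OrderRel.flip {W : U ⊕ X → U ⊕ X → Prop} (hW : OrderRel W) :
    OrderRel (fun a b => W b a) :=
  ⟨fun _ _ h => (hW.isLeft_eq _ _ h).symm, fun _ _ h _ _ h' => (hW.lt_iff _ _ h _ _ h').symm⟩

theorem orderEquivalent_iff {l l' : List (U ⊕ X)} :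
    OrderEquivalent l l' ↔ l.length = l'.length ∧ OrderRel (fun a b => (a, b) ∈ l.zip l') :=
  ⟨fun h => ⟨h.1, fun _ _ hab => h.2.1 _ hab, fun _ _ hab _ _ h' => h.2.2 _ hab _ h'⟩,
    fun h => ⟨h.1, fun _ hp => h.2.1 _ _ hp, fun _ hp _ hq => h.2.2 _ _ hp _ _ hq⟩⟩

theorem OrderRel.orderEquivalent {W : U ⊕ X → U ⊕ X → Prop} (hW : OrderRel W)
    {l l' : List (U ⊕ X)} (h : List.Forall₂ W l l') : OrderEquivalent l l' := by
  rw [List.forall₂_iff_zip] at h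
  exact orderEquivalent_iff.2 ⟨h.1, fun _ _ hab => hW.isLeft_eq _ _ (h.2 hab),
    fun _ _ hab _ _ h' => hW.lt_iff _ _ (h.2 hab) _ _ (h.2 h')⟩

theorem mem_zip_swap {α β : Type*} {l : List α} {l' : List β} {a : α} {b : β} :
    (b, a) ∈ l'.zip l ↔ (a, b) ∈ l.zip l' := by
  rw [← List.zip_swap l l', List.mem_map]
  constructor
  · rintro ⟨⟨a', b'⟩, h, h'⟩
    simp only [Prod.swap_prod_mk, Prod.mk.injEq] at h'
    rwa [h'.1, h'.2] at h
  · exact fun h => ⟨_, h, rfl⟩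

theorem exists_mem_zip_of_mem_zip {α β γ : Type*} {l : List α} {l' : List β} {l'' : List γ}
    (h : l.length = l'.length) {a : α} {c : γ} (hac : (a, c) ∈ l.zip l'') :
    ∃ b, (a, b) ∈ l.zip l' ∧ (b, c) ∈ l'.zip l'' := by
  obtain ⟨i, hi, h1⟩ := List.getElem_of_mem hac
  simp only [List.length_zip, lt_min_iff] at hi
  simp only [List.getElem_zip, Prod.mk.injEq] at h1
  refine ⟨l'[i]'(h ▸ hi.1), ?_, ?_⟩
  · rw [← h1.1, ← List.getElem_zip (h := by simp; omega)]
    exact List.getElem_mem _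
  · rw [← h1.2, ← List.getElem_zip (h := by simp; omega)]
    exact List.getElem_mem _

theorem OrderEquivalent.refl (l : List (U ⊕ X)) : OrderEquivalent l l :=
  OrderRel.eq.orderEquivalent (List.forall₂_eq_eq_eq ▸ rfl)

theorem OrderEquivalent.symm {l l' : List (U ⊕ X)} (h : OrderEquivalent l l') :
    OrderEquivalent l' l := by
  rw [orderEquivalent_iff] at *
  refine ⟨h.1.symm, ?_⟩
  have := h.2.flip
  simp only [← mem_zip_swap (l := l)] at this
  exact this

theorem OrderEquivalent.trans {l l' l'' : List (U ⊕ X)} (h : OrderEquivalent l l')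
    (h' : OrderEquivalent l' l'') : OrderEquivalent l l'' := by
  rw [orderEquivalent_iff] at *
  refine ⟨h.1.trans h'.1, ⟨fun a c hac => ?_, fun a c hac a' c' hac' => ?_⟩⟩
  · obtain ⟨b, h1, h2⟩ := exists_mem_zip_of_mem_zip h.1 hac
    exact (h.2.isLeft_eq _ _ h1).trans (h'.2.isLeft_eq _ _ h2)
  · obtain ⟨b, h1, h2⟩ := exists_mem_zip_of_mem_zip h.1 hac
    obtain ⟨b', h3, h4⟩ := exists_mem_zip_of_mem_zip h.1 hac'
    exact (h.2.lt_iff _ _ h1 _ _ h3).trans (h'.2.lt_iff _ _ h2 _ _ h4)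

/-- Messages with the same tag and related data. -/
def MessageRel {Tag : Type v} {D : Type*} (W : D → D → Prop) (μ μ' : Message Tag D) : Prop :=
  μ.tag = μ'.tag ∧ List.Forall₂ W μ.data μ'.data

/-- Outcomes that agree except that data are replaced by related ones. -/
structure OutcomeRel {Ctrl Tag : Type v} {D : Type*} (W : D → D → Prop)
    (o o' : Outcome Ctrl Tag D) : Prop where
  ctrl : o.ctrl = o'.ctrl
  mem : List.Forall₂ W o.mem o'.mem
  sends : ∀ p, List.Forall₂ (MessageRel W) (o.sends p) (o'.sends p)

theorem MessageRel.mono {Tag : Type v} {D : Type*} {W W' : D → D → Prop}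
    (h : ∀ a b, W a b → W' a b) {μ μ' : Message Tag D} (hμ : MessageRel W μ μ') :
    MessageRel W' μ μ' :=
  ⟨hμ.1, hμ.2.imp h⟩

theorem OutcomeRel.mono {Ctrl Tag : Type v} {D : Type*} {W W' : D → D → Prop}
    (h : ∀ a b, W a b → W' a b) {o o' : Outcome Ctrl Tag D} (ho : OutcomeRel W o o') :
    OutcomeRel W' o o' :=
  ⟨ho.ctrl, ho.mem.imp h, fun p => (ho.sends p).imp fun _ _ => MessageRel.mono h⟩

theorem forall₂_comp {α β γ : Type*} {R : α → β → Prop} {S : α → γ → Prop} {T : β → γ → Prop}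
    (h : ∀ a b c, R a b → S a c → T b c) {l : List α} {l' : List β} {l'' : List γ}
    (h1 : List.Forall₂ R l l') (h2 : List.Forall₂ S l l'') : List.Forall₂ T l' l'' := by
  induction h1 generalizing l'' with
  | nil => cases h2; exact .nil
  | cons hab _ ih =>
    cases h2 with
    | cons hac hl => exact .cons (h _ _ _ hab hac) (ih hl)

theorem OutcomeRel.comp {Ctrl Tag : Type v} {D : Type*} {R S T : D → D → Prop}
    (h : ∀ a b c, R a b → S a c → T b c) {o o' o'' : Outcome Ctrl Tag D}
    (h1 : OutcomeRel R o o') (h2 : OutcomeRel S o o'') : OutcomeRel T o' o'' :=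
  ⟨h1.ctrl.symm.trans h2.ctrl, forall₂_comp h h1.mem h2.mem, fun p =>
    forall₂_comp (fun _ _ _ hab hac => ⟨hab.1.symm.trans hac.1, forall₂_comp h hab.2 hac.2⟩)
      (h1.sends p) (h2.sends p)⟩

theorem outcomeRel_of_corresponds {Ctrl Tag : Type v} {D : Type u₁} {l l' : List D}
    {o o' : Outcome Ctrl Tag D} (h : Outcome.Corresponds l l' o o') :
    OutcomeRel (fun a b => (a, b) ∈ l.zip l') o o' :=
  ⟨h.1, h.2.1, h.2.2⟩

end OrderEquivalence

/-! ### Consistent resolution of nondeterminism -/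

namespace Algorithm

variable {U : Type u₁} {X : Type u₂} {Y : Type u₃} [LinearOrder U] [LinearOrder X]

/-- A choice of outcomes that treats order-equivalent situations alike. -/
structure EquivariantChoice (A : Algorithm.{u₁, u₂, u₃, v} U X Y) where
  outcome : Trigger A.Tag → A.Ctrl → List (U ⊕ X) → List (U ⊕ X) → Outcome A.Ctrl A.Tag (U ⊕ X)
  mem_step : ∀ s c m d, (A.step s c m d).Nonempty → outcome s c m d ∈ A.step s c m d
  rel : ∀ (W : U ⊕ X → U ⊕ X → Prop), OrderRel W → ∀ s c m d m' d',
    List.Forall₂ W m m' → List.Forall₂ W d d' → (A.step s c m d).Nonempty →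
      OutcomeRel W (outcome s c m d) (outcome s c m' d')

/-- Order-equivalence of pairs consisting of a memory and the data of a message. -/
def situationSetoid (U : Type u₁) (X : Type u₂) [LinearOrder U] [LinearOrder X] :
    Setoid (List (U ⊕ X) × List (U ⊕ X)) where
  r p q := p.1.length = q.1.length ∧ OrderEquivalent (p.1 ++ p.2) (q.1 ++ q.2)
  iseqv := ⟨fun _ => ⟨rfl, .refl _⟩, fun h => ⟨h.1.symm, h.2.symm⟩,
    fun h h' => ⟨h.1.trans h'.1, h.2.trans h'.2⟩⟩

theorem IsComparisonBased.step_nonempty {A : Algorithm.{u₁, u₂, u₃, v} U X Y}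
    (hA : A.IsComparisonBased) {W : U ⊕ X → U ⊕ X → Prop} (hW : OrderRel W)
    {s c m d m' d'} (hm : List.Forall₂ W m m') (hd : List.Forall₂ W d d') :
    (A.step s c m d).Nonempty ↔ (A.step s c m' d').Nonempty := by
  have h := hW.orderEquivalent (List.rel_append hm hd)
  constructor
  · rintro ⟨o, ho⟩
    obtain ⟨o', ho', -⟩ := hA.1 s c m d m' d' hm.length_eq h o ho
    exact ⟨o', ho'⟩
  · rintro ⟨o, ho⟩
    obtain ⟨o', ho', -⟩ := hA.1 s c m' d' m d hm.length_eq.symm h.symm o ho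
    exact ⟨o', ho'⟩

/-- One outcome is fixed at a representative of each order-equivalence class of situations and
transported to the other members of the class. -/
theorem IsComparisonBased.exists_equivariantChoice {A : Algorithm.{u₁, u₂, u₃, v} U X Y}
    (hA : A.IsComparisonBased) : Nonempty A.EquivariantChoice := by
  classical
  let rep (m d : List (U ⊕ X)) : List (U ⊕ X) × List (U ⊕ X) :=
    (Quotient.mk (situationSetoid U X) (m, d)).out
  have hrep (m d) : (rep m d).1.length = m.length ∧
      OrderEquivalent ((rep m d).1 ++ (rep m d).2) (m ++ d) :=
    Quotient.exact (s := situationSetoid U X) (Quotient.out_eq _)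
  have key (s c m d) (h : (A.step s c (rep m d).1 (rep m d).2).Nonempty) :=
    hA.1 s c _ _ m d (hrep m d).1 (hrep m d).2 h.some h.some_mem
  -- If no outcome is possible the value is arbitrary, since all requirements on a choice assume
  -- that the step is enabled.
  let ch (s c m d) : Outcome A.Ctrl A.Tag (U ⊕ X) :=
    if h : (A.step s c (rep m d).1 (rep m d).2).Nonempty then (key s c m d h).choose
    else ⟨c, m, fun _ => []⟩
  have hne (s c m d) (h : (A.step s c m d).Nonempty) :
      (A.step s c (rep m d).1 (rep m d).2).Nonempty := by
    obtain ⟨o, ho⟩ := h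
    obtain ⟨o', ho', -⟩ := hA.1 s c m d _ _ (hrep m d).1.symm (hrep m d).2.symm o ho
    exact ⟨o', ho'⟩
  refine ⟨⟨ch, fun s c m d h => ?_, fun W hW s c m d m' d' hm hd h => ?_⟩⟩
  · simp only [ch, hne s c m d h, dif_pos]
    exact (key s c m d _).choose_spec.1
  · have hoe := hW.orderEquivalent (List.rel_append hm hd)
    have heq : rep m d = rep m' d' := by
      have : Quotient.mk (situationSetoid U X) (m, d) = Quotient.mk (situationSetoid U X) (m', d') :=
        Quotient.sound (s := situationSetoid U X) ⟨hm.length_eq, hoe⟩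
      simp only [rep, this]
    have h1 := hne s c m d h
    have h2 : (A.step s c (rep m' d').1 (rep m' d').2).Nonempty := heq ▸ h1
    simp only [ch, h1, h2, dif_pos]
    have r1 := outcomeRel_of_corresponds (key s c m d h1).choose_spec.2
    have r2 := outcomeRel_of_corresponds (key s c m' d' h2).choose_spec.2
    have hsome : h1.some = h2.some := by congr! 2 <;> rw [heq]
    generalize (key s c m' d' h2).choose = o' at r2 ⊢
    rw [← hsome, ← heq] at r2
    -- Both outcomes are transported from the same one; right-uniqueness shows that the two
    -- transports differ exactly by `W`.
    refine OutcomeRel.comp ?_ r1 r2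
    intro a b b' hab hab'
    have hmd := List.forall₂_iff_zip.1 (List.rel_append hm hd)
    obtain ⟨b'', h3, h4⟩ := exists_mem_zip_of_mem_zip (l' := m ++ d) (hrep m d).2.1 hab'
    have : b = b'' := (orderEquivalent_iff.1 (hrep m d).2).2.right_unique hab h3
    exact hmd.2 (this ▸ h4)

end Algorithm

/-! ### Executions in phases -/

/-- What every node does in one phase: the neighbour from which it takes a message (if any), and the
outcome of its transition. -/
structure Plan (n : ℕ) (Ctrl Tag : Type v) (D : Type u₁) where
  src : Fin n → Option (Fin n)
  out : Fin n → Outcome Ctrl Tag D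

namespace Config

variable {n : ℕ} {Ctrl Tag : Type v} {D : Type u₂} {U : Type u₁} [LinearOrder U]

/-- The outcome of doing nothing at node `i`. -/
def noop (c : Config n Ctrl Tag D) (i : Fin n) : Outcome Ctrl Tag D := ⟨c.ctrl i, c.mem i, fun _ => []⟩

open scoped Classical in
/-- The configuration after the nodes in `s` have executed the plan `P`. -/
noncomputable def apply (uid : Fin n ↪ U) (G : SimpleGraph (Fin n)) (c : Config n Ctrl Tag D)
    (P : Plan n Ctrl Tag D) (s : Finset (Fin n)) : Config n Ctrl Tag D where
  ctrl := fun a => if a ∈ s then (P.out a).ctrl else c.ctrl a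
  mem := fun a => if a ∈ s then (P.out a).mem else c.mem a
  -- Receptions consume from the queue as it was before the phase, and new messages are appended
  -- behind it. The order in which the nodes move therefore does not matter.
  chan := fun a b => (if b ∈ s ∧ P.src b = some a then (c.chan a b).tail else c.chan a b) ++
    (if a ∈ s ∧ G.Adj a b then (P.out a).sends (port uid G a b) else [])
  sent := c.sent + ∑ a ∈ s, ∑ b with G.Adj a b, ((P.out a).sends (port uid G a b)).length

variable {uid : Fin n ↪ U} {G : SimpleGraph (Fin n)}

@[ext]
theorem ext' {c c' : Config n Ctrl Tag D} (h1 : ∀ i, c.ctrl i = c'.ctrl i)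
    (h2 : ∀ i, c.mem i = c'.mem i) (h3 : ∀ i j, c.chan i j = c'.chan i j)
    (h4 : c.sent = c'.sent) : c = c' := by
  cases c; cases c'
  simp only [mk.injEq]
  exact ⟨funext h1, funext h2, funext fun i => funext fun j => h3 i j, h4⟩

theorem apply_empty (c : Config n Ctrl Tag D) (P : Plan n Ctrl Tag D) :
    c.apply uid G P ∅ = c := by
  ext <;> simp [apply]

theorem perform_noop (c c' : Config n Ctrl Tag D) (i : Fin n) (h1 : c.ctrl i = c'.ctrl i)
    (h2 : c.mem i = c'.mem i) : c.perform uid G i (c'.noop i) = c := by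
  ext j
  · by_cases h : j = i
    · subst h; simp [perform, noop, h1]
    · simp [perform, h]
  · by_cases h : j = i
    · subst h; simp [perform, noop, h2]
    · simp [perform, h]
  · simp [perform, noop]
  · simp [perform, noop]

theorem apply_insert_of_src_eq_none (c : Config n Ctrl Tag D) (P : Plan n Ctrl Tag D)
    {s : Finset (Fin n)} {i : Fin n} (hi : i ∉ s) (h : P.src i = none) :
    c.apply uid G P (insert i s) = (c.apply uid G P s).perform uid G i (P.out i) := by
  classical
  ext a b
  · by_cases ha : a = i
    · subst ha; simp [perform, apply]
    · simp [perform, apply, ha]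
  · by_cases ha : a = i
    · subst ha; simp [perform, apply]
    · simp [perform, apply, ha]
  · have h1 : (b ∈ insert i s ∧ P.src b = some a) ↔ (b ∈ s ∧ P.src b = some a) := by
      by_cases hb : b = i
      · subst hb; simp [h]
      · simp [hb]
    simp only [perform, apply, h1]
    by_cases ha : a = i
    · subst ha; simp [hi]; split_ifs <;> simp
    · simp [ha]
  · simp only [perform, apply]
    rw [Finset.sum_insert hi]; ring

/-- As the queue is non-empty before the phase, removing its head commutes with appending what the
sender may already have sent in this phase. -/
theorem apply_insert_of_src_eq_some (c : Config n Ctrl Tag D) (P : Plan n Ctrl Tag D)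
    {s : Finset (Fin n)} {i j : Fin n} (hi : i ∉ s) (h : P.src i = some j)
    (hne : c.chan j i ≠ []) :
    c.apply uid G P (insert i s) =
      ((c.apply uid G P s).dequeue j i).perform uid G i (P.out i) := by
  classical
  ext a b
  · by_cases ha : a = i
    · subst ha; simp [perform, apply]
    · simp [perform, apply, ha, dequeue]
  · by_cases ha : a = i
    · subst ha; simp [perform, apply]
    · simp [perform, apply, ha, dequeue]
  · simp only [perform, apply, dequeue]
    by_cases hb : b = i
    · subst hb
      by_cases ha : a = j
      · subst ha
        have : (c.chan a b).tail ++ (if a ∈ s ∧ G.Adj a b then (P.out a).sends (port uid G a b)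
          else []) = (c.chan a b ++ (if a ∈ s ∧ G.Adj a b then (P.out a).sends (port uid G a b)
          else [])).tail := by rw [List.tail_append_of_ne_nil hne]
        by_cases hab : a = b
        · subst hab; simp [hi, h]
        · simp [hi, h, hab, this]
      · have ha' : j ≠ a := fun h => ha h.symm
        by_cases hab : a = b
        · subst hab; simp [hi, h, ha, ha']
        · simp [hi, h, ha, ha', hab]
    · by_cases ha : a = i
      · subst ha; simp [hi, hb]; split_ifs <;> simp
      · simp [ha, hb]
  · simp only [perform, apply, dequeue]
    rw [Finset.sum_insert hi]; ring

theorem sent_le_apply (c : Config n Ctrl Tag D) (P : Plan n Ctrl Tag D) (s : Finset (Fin n)) :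
    c.sent ≤ (c.apply uid G P s).sent :=
  Nat.le_add_right _ _

end Config

theorem port_injOn {n : ℕ} {U : Type u₁} [LinearOrder U] (uid : Fin n ↪ U)
    (G : SimpleGraph (Fin n)) {i j k : Fin n} (hj : G.Adj i j) (hk : G.Adj i k)
    (h : port uid G i j = port uid G i k) : j = k := by
  classical
  have key : ∀ j k, G.Adj i j → uid j < uid k → port uid G i j < port uid G i k := by
    intro j k hj hlt
    unfold port
    refine Finset.card_lt_card (Finset.ssubset_iff_of_subset ?_ |>.2 ⟨j, by simp [hj, hlt], by simp⟩)
    intro l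
    simp only [Finset.mem_filter, Finset.mem_univ, true_and]
    exact fun h => ⟨h.1, h.2.trans hlt⟩
  rcases lt_trichotomy (uid j) (uid k) with hlt | heq | hlt
  · exact absurd h (key j k hj hlt).ne
  · exact uid.injective heq
  · exact absurd h (key k j hk hlt).ne'

/-! ### Phases and their serialisation into fair executions -/

namespace Algorithm

variable {n : ℕ} {U : Type u₁} [LinearOrder U] {X : Type u₂} [LinearOrder X] {Y : Type u₃}

section Plan

variable {A : Algorithm.{u₁, u₂, u₃, v} U X Y} (ch : A.EquivariantChoice) (uid : Fin n ↪ U)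
  (G : SimpleGraph (Fin n)) (kd : ℕ ⊕ ℕ) (S : Set (Fin n)) (c : A.Configuration n)

/-- The enabledness of the receptions at port `p` by nodes in `S`. -/
def CanReceive (p : ℕ) (i j : Fin n) : Prop :=
  i ∈ S ∧ G.Adj i j ∧ port uid G i j = p ∧ c.chan j i ≠ []

/-- The enabledness of action `k` for nodes in `S`. -/
def CanAct (k : ℕ) (i : Fin n) : Prop :=
  i ∈ S ∧ A.Enabled c i k

open scoped Classical in
/-- The neighbour from which node `i` takes a message in a phase of kind `kd` in which the nodes
in `S` take part. -/
noncomputable def planSrc (i : Fin n) : Option (Fin n) :=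
  match kd with
  | .inl _ => none
  | .inr p => if h : ∃ j, CanReceive uid G S c p i j then some h.choose else none

open scoped Classical in
/-- The outcome of the transition of node `i` in a phase of kind `kd` in which the nodes in `S`
take part. -/
noncomputable def planOut (i : Fin n) : Outcome A.Ctrl A.Tag (U ⊕ X) :=
  match kd with
  | .inl k => if CanAct S c k i then ch.outcome (.act k) (c.ctrl i) (c.mem i) [] else c.noop i
  | .inr p =>
    match planSrc uid G (.inr p) S c i with
    | none => c.noop i
    | some j =>
      match (c.chan j i).head? with
      | none => c.noop i
      | some μ =>
        if A.decision c i = none then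
          ch.outcome (.receive p μ.tag) (c.ctrl i) (c.mem i) μ.data
        else c.noop i

open scoped Classical in
/-- The event that happens at node `i` in a phase of kind `kd`. -/
noncomputable def planEvent (i : Fin n) : Event n :=
  match kd with
  | .inl k => if CanAct S c k i then .act i k else .idle
  | .inr p =>
    match planSrc uid G (.inr p) S c i with
    | none => .idle
    | some j => .deliver j i

/-- The plan of a phase of kind `kd` (the action of number `k`, or the reception at port `p`) in
which the nodes in `S` take part. -/
noncomputable def plan : Plan n A.Ctrl A.Tag (U ⊕ X) :=
  ⟨planSrc uid G kd S c, planOut ch uid G kd S c⟩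

variable {uid G S c}

theorem planSrc_eq_some {p : ℕ} {i j : Fin n} :
    planSrc uid G (.inr p) S c i = some j ↔ CanReceive uid G S c p i j := by
  classical
  unfold planSrc
  simp only
  split_ifs with h
  · rw [Option.some.injEq]
    refine ⟨fun hj => hj ▸ h.choose_spec, fun hj => ?_⟩
    have h' := h.choose_spec
    exact port_injOn uid G h'.2.1 hj.2.1 (h'.2.2.1.trans hj.2.2.1.symm)
  · simp only [false_iff]
    exact fun hj => h ⟨j, hj⟩

theorem planSrc_of_notMem {i : Fin n} (hi : i ∉ S) : planSrc uid G kd S c i = none := by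
  rcases kd with k | p
  · rfl
  · rw [Option.eq_none_iff_forall_ne_some]
    intro j h
    exact hi (planSrc_eq_some.1 h).1

theorem planOut_of_notMem {i : Fin n} (hi : i ∉ S) : planOut ch uid G kd S c i = c.noop i := by
  rcases kd with k | p
  · simp [planOut, CanAct, hi]
  · simp only [planOut, planSrc_of_notMem (.inr p) hi]

theorem planOut_inl_of_canAct {k : ℕ} {i : Fin n} (h : CanAct S c k i) :
    planOut ch uid G (.inl k) S c i = ch.outcome (.act k) (c.ctrl i) (c.mem i) [] := by
  simp [planOut, h]

theorem planOut_inl_of_not_canAct {k : ℕ} {i : Fin n} (h : ¬ CanAct S c k i) :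
    planOut ch uid G (.inl k) S c i = c.noop i := by
  simp [planOut, h]

theorem planOut_inr_of_decision_ne {p : ℕ} {i : Fin n} (h : A.decision c i ≠ none) :
    planOut ch uid G (.inr p) S c i = c.noop i := by
  unfold planOut
  simp only [h, if_false]
  split
  · rfl
  · split <;> rfl

theorem planOut_inr_of_src_eq_none {p : ℕ} {i : Fin n}
    (h : planSrc uid G (.inr p) S c i = none) :
    planOut ch uid G (.inr p) S c i = c.noop i := by
  simp only [planOut, h]

theorem planOut_inr_of_src_eq_some {p : ℕ} {i j : Fin n} {μ : Message A.Tag (U ⊕ X)}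
    (h : planSrc uid G (.inr p) S c i = some j) (hμ : (c.chan j i).head? = some μ)
    (hd : A.decision c i = none) :
    planOut ch uid G (.inr p) S c i =
      ch.outcome (.receive p μ.tag) (c.ctrl i) (c.mem i) μ.data := by
  simp only [planOut, h, hμ, hd, if_true]

theorem planOut_of_decision_ne {i : Fin n} (h : A.decision c i ≠ none) :
    planOut ch uid G kd S c i = c.noop i := by
  rcases kd with k | p
  · exact planOut_inl_of_not_canAct ch fun h' => h h'.2.1
  · exact planOut_inr_of_decision_ne ch h

theorem planEvent_inr_of_src_eq_some {p : ℕ} {i j : Fin n}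
    (h : planSrc uid G (.inr p) S c i = some j) :
    planEvent uid G (.inr p) S c i = .deliver j i := by
  simp only [planEvent, h]

/-- Turns a simultaneous phase into single legal steps: until node `i` moves, its state and the
heads of its non-empty incoming queues are those at the start of the phase, from which its plan was
computed. -/
theorem step_plan {s : Finset (Fin n)} {i : Fin n} (hi : i ∉ s) :
    A.Step uid G (c.apply uid G (plan ch uid G kd S c) s) (planEvent uid G kd S c i)
      (c.apply uid G (plan ch uid G kd S c) (insert i s)) := by
  classical
  have hctrl : (c.apply uid G (plan ch uid G kd S c) s).ctrl i = c.ctrl i := by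
    simp [Config.apply, hi]
  have hmem : (c.apply uid G (plan ch uid G kd S c) s).mem i = c.mem i := by
    simp [Config.apply, hi]
  have hdec : A.decision (c.apply uid G (plan ch uid G kd S c) s) i = A.decision c i := by
    rw [decision, hctrl, hmem, decision]
  rcases kd with k | p
  · rw [Config.apply_insert_of_src_eq_none _ _ hi rfl]
    by_cases h : CanAct S c k i
    · simp only [planEvent, h, if_true]
      refine .act _ _ _ _ (hdec ▸ h.2.1) ?_
      rw [hctrl, hmem]
      simp only [plan, planOut_inl_of_canAct ch h]
      exact ch.mem_step _ _ _ _ h.2.2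
    · simp only [planEvent, h, if_false]
      rw [show (plan ch uid G (.inl k) S c).out i = c.noop i from
          planOut_inl_of_not_canAct (uid := uid) (G := G) ch h,
        Config.perform_noop (uid := uid) (G := G) _ _ _ hctrl hmem]
      exact .idle _
  · cases h : planSrc uid G (.inr p) S c i with
    | none =>
      rw [Config.apply_insert_of_src_eq_none _ _ hi h]
      simp only [planEvent, h]
      rw [show (plan ch uid G (.inr p) S c).out i = c.noop i from
          planOut_inr_of_src_eq_none ch h,
        Config.perform_noop _ _ _ hctrl hmem]
      exact .idle _
    | some j =>
      obtain ⟨-, hadj, hport, hne⟩ := planSrc_eq_some.1 h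
      rw [Config.apply_insert_of_src_eq_some _ _ hi h hne, planEvent_inr_of_src_eq_some h]
      obtain ⟨μ, l, hl⟩ := List.exists_cons_of_ne_nil hne
      have hchan : (c.apply uid G (plan ch uid G (.inr p) S c) s).chan j i = μ :: (l ++
          (if j ∈ s ∧ G.Adj j i then
            ((plan ch uid G (.inr p) S c).out j).sends (port uid G j i) else [])) := by
        simp only [Config.apply]
        rw [if_neg (fun h => hi h.1), hl, List.cons_append]
      by_cases hd : A.decision c i = none
      · refine .deliver _ _ _ μ _ (by rw [hchan]; rfl) (hdec.trans hd) ?_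
        rw [hctrl, hmem, hport]
        simp only [plan, planOut_inr_of_src_eq_some ch h (by rw [hl]; rfl) hd]
        exact ch.mem_step _ _ _ _ (A.receive_enabled _ _ _ _ _)
      · rw [show (plan ch uid G (.inr p) S c).out i = c.noop i from
            planOut_inr_of_decision_ne ch hd,
          Config.perform_noop ((c.apply uid G _ s).dequeue j i) _ _ hctrl hmem]
        exact .discard _ _ _ (by rw [hchan]; simp) (hdec ▸ hd)

end Plan

/-- The configurations at the beginning of the phases. -/
noncomputable def phase {A : Algorithm.{u₁, u₂, u₃, v} U X Y} (ch : A.EquivariantChoice)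
    (uid : Fin n ↪ U) (G : SimpleGraph (Fin n)) (kind : ℕ → ℕ ⊕ ℕ) (S : ℕ → Set (Fin n))
    (x : Fin n → X) : ℕ → A.Configuration n
  | 0 => A.initial uid G x
  | t + 1 => (phase ch uid G kind S x t).apply uid G
      (plan ch uid G (kind t) (S t) (phase ch uid G kind S x t)) Finset.univ

theorem phase_chan_of_not_adj {A : Algorithm.{u₁, u₂, u₃, v} U X Y} (ch : A.EquivariantChoice)
    (uid : Fin n ↪ U) (G : SimpleGraph (Fin n)) (kind : ℕ → ℕ ⊕ ℕ) (S : ℕ → Set (Fin n))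
    (x : Fin n → X) (t : ℕ) {i j : Fin n} (h : ¬ G.Adj i j) :
    (phase ch uid G kind S x t).chan i j = [] := by
  induction t with
  | zero => rfl
  | succ t ih => simp [phase, Config.apply, ih, h]

/-- The execution in phases of kinds `kind t` in which the nodes in `S t` take part. -/
noncomputable def phaseExecution {A : Algorithm.{u₁, u₂, u₃, v} U X Y} (ch : A.EquivariantChoice)
    (uid : Fin n ↪ U) (G : SimpleGraph (Fin n)) (kind : ℕ → ℕ ⊕ ℕ)
    (hkind : ∀ a T, ∃ t ≥ T, kind t = a) (S : ℕ → Set (Fin n)) (T₀ : ℕ)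
    (hS : ∀ t ≥ T₀, S t = Set.univ) (hn : 0 < n) (x : Fin n → X) : A.FairExecution uid G x where
  -- Each phase takes `n` time steps, one per node: at time `τ` the phase is `τ / n`, and the nodes
  -- with index below `τ % n` have moved.
  config τ := (phase ch uid G kind S x (τ / n)).apply uid G
    (plan ch uid G (kind (τ / n)) (S (τ / n)) (phase ch uid G kind S x (τ / n)))
    (Finset.univ.filter fun i => i.val < τ % n)
  event τ := planEvent uid G (kind (τ / n)) (S (τ / n)) (phase ch uid G kind S x (τ / n))
    ⟨τ % n, Nat.mod_lt _ hn⟩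
  config_zero := by simp [phase, Config.apply_empty]
  config_succ τ := by
    have h := step_plan ch (kind (τ / n)) (uid := uid) (G := G) (S := S (τ / n))
      (c := phase ch uid G kind S x (τ / n))
      (s := Finset.univ.filter fun i => i.val < τ % n) (i := ⟨τ % n, Nat.mod_lt _ hn⟩) (by simp)
    convert h using 1
    have hlt := Nat.mod_lt τ hn
    have hdm := Nat.div_add_mod τ n
    by_cases hr : τ % n + 1 = n
    · have h1 : τ + 1 = n * (τ / n + 1) := by rw [mul_add]; omega
      have h2 : (τ + 1) / n = τ / n + 1 := by rw [h1, Nat.mul_div_cancel_left _ hn]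
      have h3 : (τ + 1) % n = 0 := by rw [h1, Nat.mul_mod_right]
      rw [h2, h3]
      simp only [not_lt_zero, Finset.filter_false, Config.apply_empty]
      rw [phase]
      congr 1
      ext i
      simp only [Finset.mem_univ, Finset.mem_insert, Finset.mem_filter, true_and, true_iff,
        Fin.ext_iff]
      omega
    · have h1 : τ + 1 = (τ % n + 1) + n * (τ / n) := by omega
      have h2 : (τ + 1) / n = τ / n := by
        rw [h1, Nat.add_mul_div_left _ _ hn, Nat.div_eq_of_lt (by omega), zero_add]
      have h3 : (τ + 1) % n = τ % n + 1 := by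
        rw [h1, Nat.add_mul_mod_self_left, Nat.mod_eq_of_lt (by omega)]
      rw [h2, h3]
      congr 1
      ext i
      simp only [Finset.mem_univ, Finset.mem_insert, Finset.mem_filter, true_and, Fin.ext_iff]
      omega
  fair_act i k t := by
    -- A later phase tries action `k` with all nodes taking part; when the turn of `i` comes, its
    -- state is still that of the start of the phase, so `k` is either performed or disabled.
    obtain ⟨t', ht', hk⟩ := hkind (.inl k) (max t T₀)
    have h1 : (n * t' + i) / n = t' := by
      rw [Nat.mul_add_div hn, Nat.div_eq_of_lt i.2, add_zero]
    have h2 : (n * t' + i) % n = i := by rw [Nat.mul_add_mod, Nat.mod_eq_of_lt i.2]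
    refine ⟨n * t' + i, ?_, ?_⟩
    · have := Nat.le_mul_of_pos_left t' hn
      have := le_max_left t T₀
      omega
    · simp only [h1, h2, hk, hS t' ((le_max_right t T₀).trans ht')]
      by_cases h : CanAct Set.univ (phase ch uid G kind S x t') k i
      · left; simp [planEvent, h]
      · right
        simpa [Enabled, decision, Config.apply, CanAct] using h
  fair_deliver i j t := by
    by_cases hadj : G.Adj i j
    · obtain ⟨t', ht', hk⟩ := hkind (.inr (port uid G j i)) (max t T₀)
      have h1 : (n * t' + j) / n = t' := by
        rw [Nat.mul_add_div hn, Nat.div_eq_of_lt j.2, add_zero]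
      have h2 : (n * t' + j) % n = j := by rw [Nat.mul_add_mod, Nat.mod_eq_of_lt j.2]
      have := Nat.le_mul_of_pos_left t' hn
      have := le_max_left t T₀
      by_cases h : (phase ch uid G kind S x t').chan i j = []
      · refine ⟨n * t', by omega, .inr ?_⟩
        simp only [Nat.mul_div_cancel_left _ hn, Nat.mul_mod_right]
        simpa [Config.apply_empty] using h
      · refine ⟨n * t' + j, by omega, .inl ?_⟩
        simp only [h1, h2, hk, hS t' ((le_max_right t T₀).trans ht')]
        exact planEvent_inr_of_src_eq_some
          (planSrc_eq_some.2 ⟨Set.mem_univ _, hadj.symm, rfl, h⟩)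
    · refine ⟨n * t, Nat.le_mul_of_pos_left t hn, .inr ?_⟩
      simp only [Nat.mul_div_cancel_left _ hn, Nat.mul_mod_right]
      simp [Config.apply_empty, phase_chan_of_not_adj, hadj]

theorem phaseExecution_config_mul {A : Algorithm.{u₁, u₂, u₃, v} U X Y} (ch : A.EquivariantChoice)
    (uid : Fin n ↪ U) (G : SimpleGraph (Fin n)) (kind : ℕ → ℕ ⊕ ℕ)
    (hkind : ∀ a T, ∃ t ≥ T, kind t = a) (S : ℕ → Set (Fin n)) (T₀ : ℕ)
    (hS : ∀ t ≥ T₀, S t = Set.univ) (hn : 0 < n) (x : Fin n → X) (t : ℕ) :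
    (phaseExecution ch uid G kind hkind S T₀ hS hn x).config (n * t) =
      phase ch uid G kind S x t := by
  simp only [phaseExecution, Nat.mul_div_cancel_left _ hn, Nat.mul_mod_right]
  simp [Config.apply_empty]

theorem sent_phase_le_phaseExecution {A : Algorithm.{u₁, u₂, u₃, v} U X Y}
    (ch : A.EquivariantChoice)
    (uid : Fin n ↪ U) (G : SimpleGraph (Fin n)) (kind : ℕ → ℕ ⊕ ℕ)
    (hkind : ∀ a T, ∃ t ≥ T, kind t = a) (S : ℕ → Set (Fin n)) (T₀ : ℕ)
    (hS : ∀ t ≥ T₀, S t = Set.univ) (hn : 0 < n) (x : Fin n → X) (τ : ℕ) :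
    (phase ch uid G kind S x (τ / n)).sent ≤
      ((phaseExecution ch uid G kind hkind S T₀ hS hn x).config τ).sent :=
  Config.sent_le_apply _ _ _

theorem FairExecution.decision_succ {A : Algorithm.{u₁, u₂, u₃, v} U X Y} {uid : Fin n ↪ U}
    {G : SimpleGraph (Fin n)} {x : Fin n → X} (α : A.FairExecution uid G x) {i : Fin n} {y : Y}
    {t : ℕ} (h : A.decision (α.config t) i = some y) :
    A.decision (α.config (t + 1)) i = some y := by
  have hs := α.config_succ t
  generalize α.config (t + 1) = c' at hs ⊢
  generalize α.config t = c at hs h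
  generalize α.event t = e at hs
  cases hs with
  | idle => exact h
  | act i' k o hd ho =>
    have : i ≠ i' := by rintro rfl; simp [hd] at h
    simpa [decision, Config.perform, this] using h
  | deliver j i' μ o hμ hd ho =>
    have : i ≠ i' := by rintro rfl; simp [hd] at h
    simpa [decision, Config.perform, Config.dequeue, this] using h
  | discard => exact h

theorem FairExecution.decision_of_le {A : Algorithm.{u₁, u₂, u₃, v} U X Y} {uid : Fin n ↪ U}
    {G : SimpleGraph (Fin n)} {x : Fin n → X} (α : A.FairExecution uid G x) {i : Fin n} {y : Y}
    {t t' : ℕ} (htt' : t ≤ t') (h : A.decision (α.config t) i = some y) :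
    A.decision (α.config t') i = some y := by
  induction t', htt' using Nat.le_induction with
  | base => exact h
  | succ t' _ ih => exact α.decision_succ ih

end Algorithm

/-- In an enumeration of pairs, every first component occurs infinitely often. -/
theorem exists_recurrent_sequence : ∃ kind : ℕ → ℕ ⊕ ℕ, ∀ a T, ∃ t ≥ T, kind t = a := by
  refine ⟨fun t => (Denumerable.ofNat ((ℕ ⊕ ℕ) × ℕ) t).1, fun a T => ?_⟩
  have hinj : Function.Injective fun m : ℕ => Encodable.encode (a, m) := fun m m' h => by
    simpa using Encodable.encode_injective h
  obtain ⟨_, ⟨m, rfl⟩, h⟩ := (Set.infinite_range_of_injective hinj).exists_gt T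
  exact ⟨_, h.le, by simp⟩

/-! ### Rings -/

/-- A numbering of the nodes of a ring by the integers, modulo `n`. -/
structure CyclicLayout {n : ℕ} (G : SimpleGraph (Fin n)) where
  three_le : 3 ≤ n
  node : ℤ → Fin n
  node_eq_iff : ∀ p q, node p = node q ↔ (n : ℤ) ∣ p - q
  surjective : Function.Surjective node
  adj_iff : ∀ p j, G.Adj (node p) j ↔ j = node (p + 1) ∨ j = node (p - 1)

namespace CyclicLayout

variable {n : ℕ} {G : SimpleGraph (Fin n)} (L : CyclicLayout G) {U : Type u₁} [LinearOrder U]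
  (uid : Fin n ↪ U)

theorem adj_iff_of_unit {ε : ℤ} (hε : ε = 1 ∨ ε = -1) (p : ℤ) (j : Fin n) :
    G.Adj (L.node p) j ↔ j = L.node (p + ε) ∨ j = L.node (p - ε) := by
  rw [L.adj_iff]
  rcases hε with rfl | rfl
  · rfl
  · rw [or_comm, sub_neg_eq_add, ← sub_eq_add_neg]

theorem adj_add {ε : ℤ} (hε : ε = 1 ∨ ε = -1) (p : ℤ) : G.Adj (L.node p) (L.node (p + ε)) :=
  (L.adj_iff_of_unit hε _ _).2 (.inl rfl)

theorem exists_of_adj {p : ℤ} {j : Fin n} (h : G.Adj (L.node p) j) :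
    ∃ ε : ℤ, (ε = 1 ∨ ε = -1) ∧ j = L.node (p + ε) := by
  rcases (L.adj_iff _ _).1 h with h | h
  · exact ⟨1, .inl rfl, h⟩
  · exact ⟨-1, .inr rfl, h⟩

/-- The two neighbours would coincide only if n divided 2. -/
theorem node_sub_ne_node_add {ε : ℤ} (hε : ε = 1 ∨ ε = -1) (p : ℤ) :
    L.node (p - ε) ≠ L.node (p + ε) := by
  rw [Ne, L.node_eq_iff]
  intro h
  have h3 := L.three_le
  rcases hε with rfl | rfl
  · have : (n : ℤ) ∣ 2 := by
      rwa [show (p - 1 - (p + 1) : ℤ) = -2 by ring, dvd_neg] at h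
    have := Int.le_of_dvd (by norm_num) this
    omega
  · have : (n : ℤ) ∣ 2 := by
      rwa [show (p - -1 - (p + -1) : ℤ) = 2 by ring] at h
    have := Int.le_of_dvd (by norm_num) this
    omega

theorem port_eq {ε : ℤ} (hε : ε = 1 ∨ ε = -1) (p : ℤ) :
    port uid G (L.node p) (L.node (p + ε)) =
      if uid (L.node (p - ε)) < uid (L.node (p + ε)) then 1 else 0 := by
  classical
  unfold port
  split_ifs with h
  · rw [Finset.card_eq_one]
    refine ⟨L.node (p - ε), ?_⟩
    ext k
    simp only [Finset.mem_filter, Finset.mem_univ, true_and, Finset.mem_singleton,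
      L.adj_iff_of_unit hε]
    constructor
    · rintro ⟨rfl | rfl, h'⟩
      · exact absurd h' (lt_irrefl _)
      · rfl
    · rintro rfl
      exact ⟨.inr rfl, h⟩
  · rw [Finset.card_eq_zero]
    ext k
    simp only [Finset.mem_filter, Finset.mem_univ, true_and, Finset.notMem_empty, iff_false,
      L.adj_iff_of_unit hε]
    rintro ⟨rfl | rfl, h'⟩
    · exact absurd h' (lt_irrefl _)
    · exact h h'

theorem neighbourUids_eq {ε : ℤ} (hε : ε = 1 ∨ ε = -1) {p : ℤ}
    (h : uid (L.node (p - ε)) < uid (L.node (p + ε))) :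
    neighbourUids uid G (L.node p) = [uid (L.node (p - ε)), uid (L.node (p + ε))] := by
  classical
  unfold neighbourUids
  have : (Finset.univ.filter fun k => G.Adj (L.node p) k).map uid =
      insert (uid (L.node (p - ε))) {uid (L.node (p + ε))} := by
    ext u
    simp only [Finset.mem_map, Finset.mem_filter, Finset.mem_univ, true_and,
      L.adj_iff_of_unit hε, Finset.mem_insert, Finset.mem_singleton]
    constructor
    · rintro ⟨k, rfl | rfl, rfl⟩ <;> simp
    · rintro (rfl | rfl)
      · exact ⟨_, .inr rfl, rfl⟩
      · exact ⟨_, .inl rfl, rfl⟩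
  rw [this, Finset.sort_insert _ (by simpa using h.le) (by simpa using h.ne)]
  simp

variable {X : Type u₂} [LinearOrder X] (x : Fin n → X)

/-- The data of the nodes at distance at most `w` from `p` and from `q` are ordered in the same
way. -/
def WindowEquiv (w : ℕ) (p q : ℤ) : Prop :=
  ∀ i j : ℤ, |i| ≤ w → |j| ≤ w →
    (uid (L.node (p + i)) < uid (L.node (p + j)) ↔ uid (L.node (q + i)) < uid (L.node (q + j))) ∧
    (x (L.node (p + i)) < x (L.node (p + j)) ↔ x (L.node (q + i)) < x (L.node (q + j)))

/-- The correspondence of the data of the nodes at distance at most `w` from `p` with those of the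
nodes at distance at most `w` from `q`. -/
inductive WindowRel (w : ℕ) (p q : ℤ) : U ⊕ X → U ⊕ X → Prop
  | uid (i : ℤ) : |i| ≤ w →
      WindowRel w p q (.inl (uid (L.node (p + i)))) (.inl (uid (L.node (q + i))))
  | value (i : ℤ) : |i| ≤ w →
      WindowRel w p q (.inr (x (L.node (p + i)))) (.inr (x (L.node (q + i))))

variable {L uid x}

theorem WindowEquiv.orderRel {w : ℕ} {p q : ℤ} (h : L.WindowEquiv uid x w p q) :
    OrderRel (L.WindowRel uid x w p q) where
  isLeft_eq := by rintro _ _ (_ | _) <;> rfl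
  lt_iff := by
    rintro _ _ (⟨i, hi⟩ | ⟨i, hi⟩) _ _ (⟨j, hj⟩ | ⟨j, hj⟩)
    · simpa using (h i j hi hj).1
    · simp
    · simp
    · simpa using (h i j hi hj).2

theorem WindowEquiv.shift {w : ℕ} {p q : ℤ} (h : L.WindowEquiv uid x (w + 1) p q) {ε : ℤ}
    (hε : |ε| ≤ 1) : L.WindowEquiv uid x w (p + ε) (q + ε) := by
  intro i j hi hj
  have hi' : |ε + i| ≤ (w + 1 : ℕ) := (abs_add_le _ _).trans (by push_cast; linarith)
  have hj' : |ε + j| ≤ (w + 1 : ℕ) := (abs_add_le _ _).trans (by push_cast; linarith)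
  simpa only [add_assoc] using h _ _ hi' hj'

theorem WindowEquiv.of_succ {w : ℕ} {p q : ℤ} (h : L.WindowEquiv uid x (w + 1) p q) :
    L.WindowEquiv uid x w p q := by
  simpa using h.shift (ε := 0) (by simp)

theorem WindowRel.shift {w : ℕ} {p q : ℤ} {ε : ℤ} (hε : |ε| ≤ 1) {a b : U ⊕ X}
    (h : L.WindowRel uid x w (p + ε) (q + ε) a b) : L.WindowRel uid x (w + 1) p q a b := by
  cases h with
  | uid i hi =>
    rw [add_assoc, add_assoc]
    exact .uid _ ((abs_add_le _ _).trans (by push_cast; linarith))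
  | value i hi =>
    rw [add_assoc, add_assoc]
    exact .value _ ((abs_add_le _ _).trans (by push_cast; linarith))

theorem WindowRel.succ {w : ℕ} {p q : ℤ} {a b : U ⊕ X}
    (h : L.WindowRel uid x w p q a b) : L.WindowRel uid x (w + 1) p q a b := by
  rw [← add_zero p, ← add_zero q] at h
  exact h.shift (by simp)

theorem abs_le_one_of_unit {ε : ℤ} (hε : ε = 1 ∨ ε = -1) : |ε| ≤ 1 := by
  rcases hε with rfl | rfl <;> simp

/-- On a ring a port is decided by one comparison of UIDs at distance 1, which is why windows need
radius at least 1. -/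
theorem WindowEquiv.port_eq {w : ℕ} (hw : 1 ≤ w) {p q : ℤ} (h : L.WindowEquiv uid x w p q) {ε : ℤ}
    (hε : ε = 1 ∨ ε = -1) :
    port uid G (L.node p) (L.node (p + ε)) = port uid G (L.node q) (L.node (q + ε)) := by
  have h1 : |ε| ≤ (w : ℤ) := (abs_le_one_of_unit hε).trans (by exact_mod_cast hw)
  rw [L.port_eq uid hε, L.port_eq uid hε, sub_eq_add_neg, sub_eq_add_neg]
  simp only [(h (-ε) ε (by rwa [abs_neg]) h1).1]

theorem WindowEquiv.forall₂_neighbourUids {w : ℕ} (hw : 1 ≤ w) {p q : ℤ}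
    (h : L.WindowEquiv uid x w p q) :
    List.Forall₂ (L.WindowRel uid x w p q) ((neighbourUids uid G (L.node p)).map Sum.inl)
      ((neighbourUids uid G (L.node q)).map Sum.inl) := by
  have key : ∀ ε : ℤ, (ε = 1 ∨ ε = -1) → uid (L.node (p - ε)) < uid (L.node (p + ε)) →
      List.Forall₂ (L.WindowRel uid x w p q) ((neighbourUids uid G (L.node p)).map Sum.inl)
      ((neighbourUids uid G (L.node q)).map Sum.inl) := by
    intro ε hε hlt
    have h1 : |ε| ≤ (w : ℤ) := (abs_le_one_of_unit hε).trans (by exact_mod_cast hw)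
    have h2 : |-ε| ≤ (w : ℤ) := by rwa [abs_neg]
    have hlt' : uid (L.node (q - ε)) < uid (L.node (q + ε)) := by
      rw [sub_eq_add_neg] at hlt ⊢
      exact (h _ _ h2 h1).1.1 hlt
    rw [L.neighbourUids_eq uid hε hlt, L.neighbourUids_eq uid hε hlt', sub_eq_add_neg,
      sub_eq_add_neg]
    exact .cons (.uid _ h2) (.cons (.uid _ h1) .nil)
  rcases lt_or_gt_of_ne (uid.injective.ne (L.node_sub_ne_node_add (.inl rfl) p)) with hlt | hlt
  · exact key 1 (.inl rfl) hlt
  · exact key (-1) (.inr rfl) (by rwa [sub_neg_eq_add, ← sub_eq_add_neg])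

end CyclicLayout

/-! ### Local correspondence of configurations during one phase -/

namespace Algorithm

open CyclicLayout

variable {n : ℕ} {U : Type u₁} [LinearOrder U] {X : Type u₂} [LinearOrder X] {Y : Type u₃}
  {G : SimpleGraph (Fin n)} (L : CyclicLayout G) {uid : Fin n ↪ U}
  {A : Algorithm.{u₁, u₂, u₃, v} U X Y}

/-- The states of the nodes at `p` and `q`, and the messages on their way to these nodes, agree up
to replacing data by related ones. -/
structure LocalRel (W : U ⊕ X → U ⊕ X → Prop) (c c' : A.Configuration n) (p q : ℤ) : Prop where
  ctrl : c.ctrl (L.node p) = c'.ctrl (L.node q)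
  mem : List.Forall₂ W (c.mem (L.node p)) (c'.mem (L.node q))
  chan : ∀ ε : ℤ, ε = 1 ∨ ε = -1 → List.Forall₂ (MessageRel W)
    (c.chan (L.node (p + ε)) (L.node p)) (c'.chan (L.node (q + ε)) (L.node q))

variable {L}

theorem LocalRel.mono {W W' : U ⊕ X → U ⊕ X → Prop} (hW : ∀ a b, W a b → W' a b)
    {c c' : A.Configuration n} {p q : ℤ} (h : LocalRel L W c c' p q) : LocalRel L W' c c' p q :=
  ⟨h.ctrl, h.mem.imp hW, fun ε hε => (h.chan ε hε).imp fun _ _ => MessageRel.mono hW⟩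

theorem localRel_initial {x : Fin n → X} {w : ℕ} (hw : 1 ≤ w) {p q : ℤ}
    (h : L.WindowEquiv uid x w p q) :
    LocalRel L (L.WindowRel uid x w p q) (A.initial uid G x) (A.initial uid G x) p q where
  ctrl := rfl
  mem := by
    refine .cons ?_ (.cons ?_ (h.forall₂_neighbourUids hw))
    · simpa using WindowRel.uid (L := L) (uid := uid) (x := x) (w := w) (p := p) (q := q) 0 (by simp)
    · simpa using
        WindowRel.value (L := L) (uid := uid) (x := x) (w := w) (p := p) (q := q) 0 (by simp)
  chan _ _ := .nil

theorem localRel_initial_eq {x x' : Fin n → X} {p : ℤ} (h : x (L.node p) = x' (L.node p)) :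
    LocalRel L Eq (A.initial uid G x) (A.initial uid G x') p p where
  ctrl := rfl
  mem := by simp [initial, h]
  chan _ _ := .nil

theorem IsComparisonBased.decision_eq_none_iff (hA : A.IsComparisonBased)
    {W : U ⊕ X → U ⊕ X → Prop} (hW : OrderRel W) {c c' : A.Configuration n} {p q : ℤ}
    (h : LocalRel L W c c' p q) :
    A.decision c (L.node p) = none ↔ A.decision c' (L.node q) = none := by
  have := hA.2 (c.ctrl (L.node p)) _ _ (hW.orderEquivalent h.mem)
  rw [← not_iff_not, ← Ne, ← Ne, ← Option.isSome_iff_ne_none, ← Option.isSome_iff_ne_none,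
    decision, decision, this, h.ctrl]

theorem LocalRel.planSrc_iff {W : U ⊕ X → U ⊕ X → Prop}
    {c c' : A.Configuration n} {p q : ℤ}
    (h : LocalRel L W c c' p q) {S S' : Set (Fin n)} (hS : L.node p ∈ S ↔ L.node q ∈ S')
    (hport : ∀ ε : ℤ, ε = 1 ∨ ε = -1 →
      port uid G (L.node p) (L.node (p + ε)) = port uid G (L.node q) (L.node (q + ε)))
    (kd : ℕ ⊕ ℕ) {ε : ℤ} (hε : ε = 1 ∨ ε = -1) :
    planSrc uid G kd S c (L.node p) = some (L.node (p + ε)) ↔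
      planSrc uid G kd S' c' (L.node q) = some (L.node (q + ε)) := by
  rcases kd with k | r
  · simp [planSrc]
  · rw [planSrc_eq_some, planSrc_eq_some]
    unfold CanReceive
    rw [hS, hport ε hε, ← List.length_pos_iff, ← List.length_pos_iff, (h.chan ε hε).length_eq]
    simp only [L.adj_add hε]

theorem LocalRel.noop {W : U ⊕ X → U ⊕ X → Prop} {c c' : A.Configuration n} {p q : ℤ}
    (h : LocalRel L W c c' p q) : OutcomeRel W (c.noop (L.node p)) (c'.noop (L.node q)) :=
  ⟨h.ctrl, h.mem, fun _ => .nil⟩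

/-- Whether the node has stopped, which action is enabled, which queue is non-empty and the tag at
its head are all the same on both sides, so the same branch of the plan is taken and equivariance of
the choice applies. -/
theorem LocalRel.outcomeRel (hA : A.IsComparisonBased) (ch : A.EquivariantChoice)
    {W : U ⊕ X → U ⊕ X → Prop} (hW : OrderRel W) {c c' : A.Configuration n} {p q : ℤ}
    (h : LocalRel L W c c' p q) {S S' : Set (Fin n)} (hS : L.node p ∈ S ↔ L.node q ∈ S')
    (hport : ∀ ε : ℤ, ε = 1 ∨ ε = -1 →
      port uid G (L.node p) (L.node (p + ε)) = port uid G (L.node q) (L.node (q + ε)))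
    (kd : ℕ ⊕ ℕ) :
    OutcomeRel W (planOut ch uid G kd S c (L.node p)) (planOut ch uid G kd S' c' (L.node q)) := by
  have hdec := hA.decision_eq_none_iff hW h
  by_cases hd : A.decision c (L.node p) = none
  swap
  · rw [planOut_of_decision_ne ch kd hd, planOut_of_decision_ne ch kd fun hd' => hd (hdec.2 hd')]
    exact h.noop
  have hd' := hdec.1 hd
  rcases kd with k | r
  · have hiff : CanAct S c k (L.node p) ↔ CanAct S' c' k (L.node q) := by
      unfold CanAct Enabled
      rw [hS, hdec, h.ctrl, hA.step_nonempty hW h.mem .nil]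
    by_cases hc : CanAct S c k (L.node p)
    · rw [planOut_inl_of_canAct ch hc, planOut_inl_of_canAct ch (hiff.1 hc), ← h.ctrl]
      exact ch.rel W hW _ _ _ _ _ _ h.mem .nil hc.2.2
    · rw [planOut_inl_of_not_canAct ch hc, planOut_inl_of_not_canAct ch (hiff.not.1 hc)]
      exact h.noop
  · by_cases hs : ∃ ε : ℤ, (ε = 1 ∨ ε = -1) ∧
        planSrc uid G (.inr r) S c (L.node p) = some (L.node (p + ε))
    · obtain ⟨ε, hε, hs⟩ := hs
      have hs' := (h.planSrc_iff hS hport (.inr r) hε).1 hs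
      have hch := h.chan ε hε
      obtain ⟨μ, l, hl⟩ := List.exists_cons_of_ne_nil (planSrc_eq_some.1 hs).2.2.2
      obtain ⟨μ', l', hl'⟩ := List.exists_cons_of_ne_nil (planSrc_eq_some.1 hs').2.2.2
      rw [hl, hl'] at hch
      obtain ⟨htag, hdata⟩ := (List.forall₂_cons.1 hch).1
      rw [planOut_inr_of_src_eq_some ch hs (by rw [hl]; rfl) hd,
        planOut_inr_of_src_eq_some ch hs' (by rw [hl']; rfl) hd', ← h.ctrl, ← htag]
      exact ch.rel W hW _ _ _ _ _ _ h.mem hdata (A.receive_enabled _ _ _ _ _)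
    · have h1 : planSrc uid G (.inr r) S c (L.node p) = none := by
        rw [Option.eq_none_iff_forall_ne_some]
        intro j hj
        obtain ⟨ε, hε, rfl⟩ := L.exists_of_adj (planSrc_eq_some.1 hj).2.1
        exact hs ⟨ε, hε, hj⟩
      have h2 : planSrc uid G (.inr r) S' c' (L.node q) = none := by
        rw [Option.eq_none_iff_forall_ne_some]
        intro j hj
        obtain ⟨ε, hε, rfl⟩ := L.exists_of_adj (planSrc_eq_some.1 hj).2.1
        exact hs ⟨ε, hε, (h.planSrc_iff hS hport (.inr r) hε).2 hj⟩
      rw [planOut_inr_of_src_eq_none ch h1, planOut_inr_of_src_eq_none ch h2]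
      exact h.noop

/-- The messages that the node at `p + ε` sends to the node at `p` in a phase. -/
noncomputable abbrev sendsTo (L : CyclicLayout G) (uid : Fin n ↪ U) (P : Plan n A.Ctrl A.Tag (U ⊕ X))
    (p ε : ℤ) : List (Message A.Tag (U ⊕ X)) :=
  (P.out (L.node (p + ε))).sends (port uid G (L.node (p + ε)) (L.node p))

theorem LocalRel.apply {W : U ⊕ X → U ⊕ X → Prop} {c c' : A.Configuration n} {p q : ℤ}
    (h : LocalRel L W c c' p q) {P P' : Plan n A.Ctrl A.Tag (U ⊕ X)}
    (hout : OutcomeRel W (P.out (L.node p)) (P'.out (L.node q)))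
    (hsrc : ∀ ε : ℤ, ε = 1 ∨ ε = -1 →
      (P.src (L.node p) = some (L.node (p + ε)) ↔ P'.src (L.node q) = some (L.node (q + ε))))
    (hsends : ∀ ε : ℤ, ε = 1 ∨ ε = -1 →
      List.Forall₂ (MessageRel W) (sendsTo L uid P p ε) (sendsTo L uid P' q ε)) :
    LocalRel L W (c.apply uid G P Finset.univ) (c'.apply uid G P' Finset.univ) p q where
  ctrl := by simpa [Config.apply] using hout.ctrl
  mem := by simpa [Config.apply] using hout.mem
  chan ε hε := by
    have h1 := h.chan ε hε
    simp only [Config.apply, Finset.mem_univ, true_and, (L.adj_add hε _).symm, if_true]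
    refine List.rel_append ?_ (hsends ε hε)
    simp only [hsrc ε hε]
    split_ifs
    · generalize c.chan (L.node (p + ε)) (L.node p) = l at h1
      generalize c'.chan (L.node (q + ε)) (L.node q) = l' at h1
      cases h1 with
      | nil => exact .nil
      | cons _ h1 => exact h1
    · exact h1

end Algorithm

/-! ### The number of messages on a repetitive ring -/

/-- Every window of radius at most `K` has many order-equivalent copies on the ring. -/
def CyclicLayout.Repetitive {n : ℕ} {G : SimpleGraph (Fin n)} (L : CyclicLayout G) {U : Type u₁}
    [LinearOrder U] (uid : Fin n ↪ U) {X : Type u₂} [LinearOrder X] (x : Fin n → X) (K : ℕ) : Prop :=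
  ∀ w, 1 ≤ w → w ≤ K → ∀ p,
    n ≤ 16 * w * {i | ∃ q, L.node q = i ∧ L.WindowEquiv uid x w p q}.ncard

namespace Algorithm

open CyclicLayout

variable {n : ℕ} {U : Type u₁} [LinearOrder U] {X : Type u₂} [LinearOrder X] {Y : Type u₃}
  {G : SimpleGraph (Fin n)} (L : CyclicLayout G) (uid : Fin n ↪ U)
  {A : Algorithm.{u₁, u₂, u₃, v} U X Y}

/-- Some message is sent when the plan `P` is executed. -/
def Active (P : Plan n A.Ctrl A.Tag (U ⊕ X)) : Prop :=
  ∃ p ε : ℤ, (ε = 1 ∨ ε = -1) ∧ sendsTo L uid P p ε ≠ []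

variable (ch : A.EquivariantChoice) (kind : ℕ → ℕ ⊕ ℕ) (S : ℕ → Set (Fin n)) (x : Fin n → X)

/-- The plan of the phase number `t`. -/
noncomputable abbrev phasePlan (G : SimpleGraph (Fin n)) (t : ℕ) : Plan n A.Ctrl A.Tag (U ⊕ X) :=
  plan ch uid G (kind t) (S t) (phase ch uid G kind S x t)

open scoped Classical in
/-- The number of phases before `t` in which messages are sent. -/
noncomputable def activeCount (t : ℕ) : ℕ :=
  Nat.count (fun t => Active L uid (phasePlan uid ch kind (fun _ => Set.univ) x G t)) t

variable {L uid ch kind S x}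

theorem activeCount_succ_of_active {t : ℕ}
    (h : Active L uid (phasePlan uid ch kind (fun _ => Set.univ) x G t)) :
    activeCount L uid ch kind x (t + 1) = activeCount L uid ch kind x t + 1 := by
  classical
  simp [activeCount, Nat.count_succ, h]

theorem activeCount_succ_of_not_active {t : ℕ}
    (h : ¬ Active L uid (phasePlan uid ch kind (fun _ => Set.univ) x G t)) :
    activeCount L uid ch kind x (t + 1) = activeCount L uid ch kind x t := by
  classical
  simp [activeCount, Nat.count_succ, h]

theorem sendsTo_eq_nil_of_not_active {P : Plan n A.Ctrl A.Tag (U ⊕ X)} (h : ¬ Active L uid P)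
    (p : ℤ) {ε : ℤ} (hε : ε = 1 ∨ ε = -1) : sendsTo L uid P p ε = [] := by
  by_contra h'
  exact h ⟨p, ε, hε, h'⟩

theorem _root_.CyclicLayout.WindowEquiv.port_toward_eq {w : ℕ} (hw : 1 ≤ w) {p q ε : ℤ}
    (hε : ε = 1 ∨ ε = -1) (h : L.WindowEquiv uid x w (p + ε) (q + ε)) :
    port uid G (L.node (p + ε)) (L.node p) = port uid G (L.node (q + ε)) (L.node q) := by
  have hε' : -ε = 1 ∨ -ε = -1 := by rcases hε with rfl | rfl <;> simp
  simpa using h.port_eq hw hε'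

/-- Information travels one edge per active phase and not at all in the others. The additional 1 in
the radius accounts for the neighbours' UIDs and the port numbers, known from the start. -/
theorem localRel_phase (hA : A.IsComparisonBased) (t : ℕ) : ∀ p q : ℤ,
    L.WindowEquiv uid x (activeCount L uid ch kind x t + 1) p q →
    LocalRel L (L.WindowRel uid x (activeCount L uid ch kind x t + 1) p q)
      (phase ch uid G kind (fun _ => Set.univ) x t) (phase ch uid G kind (fun _ => Set.univ) x t)
      p q := by
  induction t with
  | zero => exact fun p q h => localRel_initial (Nat.le_add_left _ _) h
  | succ t ih =>
    intro p q h
    have hout : ∀ p q, L.WindowEquiv uid x (activeCount L uid ch kind x t + 1) p q →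
        OutcomeRel (L.WindowRel uid x (activeCount L uid ch kind x t + 1) p q)
          ((phasePlan uid ch kind (fun _ => Set.univ) x G t).out (L.node p))
          ((phasePlan uid ch kind (fun _ => Set.univ) x G t).out (L.node q)) := fun p q h =>
      (ih p q h).outcomeRel hA ch h.orderRel (by simp) (fun ε hε => h.port_eq (by omega) hε) _
    by_cases hact : Active L uid (phasePlan uid ch kind (fun _ => Set.univ) x G t)
    · rw [activeCount_succ_of_active hact] at h ⊢
      have h' := h.of_succ
      refine ((ih p q h').mono fun _ _ => WindowRel.succ).apply
        ((hout p q h').mono fun _ _ => WindowRel.succ)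
        (fun ε hε => (ih p q h').planSrc_iff (by simp)
          (fun ε hε => h'.port_eq (by omega) hε) _ hε) fun ε hε => ?_
      -- The messages come from the neighbour at `p + ε`, whose smaller window lies inside the
      -- enlarged window of `p`.
      have hs := h.shift (abs_le_one_of_unit hε)
      rw [sendsTo, sendsTo, hs.port_toward_eq (by omega) hε]
      exact ((hout _ _ hs).sends _).imp fun _ _ =>
        MessageRel.mono fun _ _ => WindowRel.shift (abs_le_one_of_unit hε)
    · rw [activeCount_succ_of_not_active hact] at h ⊢
      refine (ih p q h).apply (hout p q h)
        (fun ε hε => (ih p q h).planSrc_iff (by simp)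
          (fun ε hε => h.port_eq (by omega) hε) _ hε) fun ε hε => ?_
      rw [sendsTo_eq_nil_of_not_active hact p hε, sendsTo_eq_nil_of_not_active hact q hε]
      exact .nil

/-- Every node with the same window as a sender is in a corresponding state, hence sends as well,
and repetitiveness counts these nodes. -/
theorem sent_add_le_of_active (hA : A.IsComparisonBased) {K : ℕ} (hrep : L.Repetitive uid x K)
    {t : ℕ} (ht : activeCount L uid ch kind x t < K)
    (hact : Active L uid (phasePlan uid ch kind (fun _ => Set.univ) x G t)) :
    ((phase ch uid G kind (fun _ => Set.univ) x t).sent : ℝ) +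
        n / (16 * ((activeCount L uid ch kind x t : ℝ) + 1)) ≤
      (phase ch uid G kind (fun _ => Set.univ) x (t + 1)).sent := by
  classical
  obtain ⟨p, ε, hε, hne⟩ := hact
  have hε' : -ε = 1 ∨ -ε = -1 := by rcases hε with rfl | rfl <;> simp
  set k := activeCount L uid ch kind x t with hk
  set P := phasePlan uid ch kind (fun _ => Set.univ) x G t with hP
  have hcard := hrep (k + 1) (by omega) ht (p + ε)
  set Q := {i | ∃ q, L.node q = i ∧ L.WindowEquiv uid x (k + 1) (p + ε) q} with hQ
  have hsend : ∀ i ∈ Q, 1 ≤ ∑ b with G.Adj i b, ((P.out i).sends (port uid G i b)).length := by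
    rintro _ ⟨q, rfl, hq⟩
    have hport := hq.port_eq (by omega) hε'
    rw [show p + ε + -ε = p by ring] at hport
    have hlen := (((localRel_phase hA t _ _ hq).outcomeRel hA ch hq.orderRel
      (S := Set.univ) (S' := Set.univ) (by simp) (fun ε hε => hq.port_eq (by omega) hε) (kind t)).sends
        (port uid G (L.node (p + ε)) (L.node p))).length_eq
    have hpos := List.length_pos_iff.2 hne
    refine le_trans ?_ (Finset.single_le_sum (fun _ _ => Nat.zero_le _)
      (Finset.mem_filter.2 ⟨Finset.mem_univ (L.node (q + -ε)), L.adj_add hε' _⟩))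
    rw [← hport]
    exact (Nat.succ_le_of_lt hpos).trans hlen.le
  have hle : Q.ncard ≤ ∑ i, ∑ b with G.Adj i b, ((P.out i).sends (port uid G i b)).length := by
    rw [Set.ncard_eq_toFinset_card', Finset.card_eq_sum_ones]
    refine (Finset.sum_le_sum fun i hi => hsend i (Set.mem_toFinset.1 hi)).trans ?_
    exact Finset.sum_le_sum_of_subset (Finset.subset_univ _)
  have hsent : (phase ch uid G kind (fun _ => Set.univ) x (t + 1)).sent =
      (phase ch uid G kind (fun _ => Set.univ) x t).sent +
        ∑ i, ∑ b with G.Adj i b, ((P.out i).sends (port uid G i b)).length := by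
    rw [phase]
    simp only [Config.apply]
    convert rfl
  rw [hsent]
  push_cast
  have h1 : (n : ℝ) ≤ 16 * ((k : ℝ) + 1) * Q.ncard := by exact_mod_cast hcard
  have h2 : (Q.ncard : ℝ) ≤ ((∑ i, ∑ b with G.Adj i b,
    ((P.out i).sends (port uid G i b)).length : ℕ) : ℝ) := by exact_mod_cast hle
  push_cast at h2
  have h3 : (n : ℝ) / (16 * ((k : ℝ) + 1)) ≤ Q.ncard := by
    rw [div_le_iff₀ (by positivity)]; linarith
  linarith

theorem sum_le_sent_phase (hA : A.IsComparisonBased) {K : ℕ} (hrep : L.Repetitive uid x K)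
    (t : ℕ) :
    ∑ j ∈ Finset.range (min K (activeCount L uid ch kind x t)), (n : ℝ) / (16 * ((j : ℝ) + 1)) ≤
      (phase ch uid G kind (fun _ => Set.univ) x t).sent := by
  induction t with
  | zero => simp [activeCount]
  | succ t ih =>
    have hmono : ((phase ch uid G kind (fun _ => Set.univ) x t).sent : ℝ) ≤
        (phase ch uid G kind (fun _ => Set.univ) x (t + 1)).sent := by
      exact_mod_cast Config.sent_le_apply _ _ _
    by_cases hact : Active L uid (phasePlan uid ch kind (fun _ => Set.univ) x G t)
    · rw [activeCount_succ_of_active hact]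
      by_cases hK : activeCount L uid ch kind x t < K
      · rw [min_eq_right hK, Finset.sum_range_succ]
        rw [min_eq_right hK.le] at ih
        have := sent_add_le_of_active hA hrep hK hact
        linarith
      · rw [min_eq_left (by omega)] at ih ⊢
        exact ih.trans hmono
    · rw [activeCount_succ_of_not_active hact]
      exact ih.trans hmono

theorem activeCount_mono : Monotone (activeCount L uid ch kind x) := by
  classical
  exact Nat.count_monotone _

theorem activeCount_succ_le (t : ℕ) :
    activeCount L uid ch kind x (t + 1) ≤ activeCount L uid ch kind x t + 1 := by
  by_cases hact : Active L uid (phasePlan uid ch kind (fun _ => Set.univ) x G t)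
  · exact (activeCount_succ_of_active hact).le
  · exact (activeCount_succ_of_not_active hact).le.trans (Nat.le_succ _)

/-- The initial values at distance more than `K` from `p₀` do not influence the node at `p₀` before
more than `K` phases with messages have passed. -/
theorem localRel_eq_phase (hA : A.IsComparisonBased) {x' : Fin n → X} {p₀ : ℤ} {K T : ℕ}
    (hx : ∀ p : ℤ, |p - p₀| ≤ K → x (L.node p) = x' (L.node p))
    (hS : ∀ t < T, S t = {i | ∃ p : ℤ, |p - p₀| + activeCount L uid ch kind x t ≤ K ∧
      L.node p = i}) (t : ℕ) (ht : t ≤ T) :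
    ∀ p : ℤ, |p - p₀| + activeCount L uid ch kind x t ≤ K →
      LocalRel L Eq (phase ch uid G kind (fun _ => Set.univ) x t) (phase ch uid G kind S x' t)
        p p := by
  induction t with
  | zero => exact fun p hp => localRel_initial_eq (hx p (by simpa [activeCount] using hp))
  | succ t ih =>
    intro p hp
    have ih := ih (by omega)
    have hmem : ∀ p : ℤ, |p - p₀| + activeCount L uid ch kind x t ≤ K → L.node p ∈ S t :=
      fun p hp => by rw [hS t (by omega)]; exact ⟨p, hp, rfl⟩
    have hout : ∀ p : ℤ, |p - p₀| + activeCount L uid ch kind x t ≤ K →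
        OutcomeRel Eq ((phasePlan uid ch kind (fun _ => Set.univ) x G t).out (L.node p))
          ((phasePlan uid ch kind S x' G t).out (L.node p)) := fun p hp =>
      (ih p hp).outcomeRel hA ch OrderRel.eq (by simp [hmem p hp]) (fun _ _ => rfl) _
    have hp' : |p - p₀| + activeCount L uid ch kind x t ≤ K := by
      have := activeCount_mono (L := L) (uid := uid) (ch := ch) (kind := kind) (x := x)
        (Nat.le_succ t)
      have : (activeCount L uid ch kind x t : ℤ) ≤ activeCount L uid ch kind x (t + 1) := by
        exact_mod_cast this
      linarith
    refine (ih p hp').apply (hout p hp')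
      (fun ε hε => (ih p hp').planSrc_iff (by simp [hmem p hp']) (fun _ _ => rfl) _ hε)
      fun ε hε => ?_
    by_cases hact : Active L uid (phasePlan uid ch kind (fun _ => Set.univ) x G t)
    · rw [activeCount_succ_of_active hact] at hp
      refine (hout (p + ε) ?_).sends _
      have : |p + ε - p₀| ≤ |p - p₀| + |ε| := by
        rw [show p + ε - p₀ = (p - p₀) + ε by ring]; exact abs_add_le _ _
      have := abs_le_one_of_unit hε
      push_cast at hp
      linarith
    · have hnil := sendsTo_eq_nil_of_not_active hact p hε
      rw [hnil]
      suffices sendsTo L uid (phasePlan uid ch kind S x' G t) p ε = [] by rw [this]; exact .nil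
      -- A participating neighbour acts as in the execution from `x`, where this phase is silent; a
      -- frozen one sends nothing.
      by_cases hin : L.node (p + ε) ∈ S t
      · rw [hS t (by omega)] at hin
        obtain ⟨q, hq, hq'⟩ := hin
        have := (hout q hq).sends (port uid G (L.node (p + ε)) (L.node p))
        rw [hq'] at this
        rw [sendsTo] at hnil
        rw [hnil] at this
        exact List.forall₂_nil_left_iff.1 this
      · have : (phasePlan uid ch kind S x' G t).out (L.node (p + ε)) = Config.noop _ _ :=
          planOut_of_notMem ch (kind t) hin
        rw [sendsTo, this]
        rfl

/-- On a ring whose windows have many order-equivalent copies, an algorithm sends many messages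
if the result is not determined by the initial values near some node. -/
theorem exists_sum_le_messages (hA : A.IsComparisonBased) {𝒢 : Set (SimpleGraph (Fin n))}
    {f : (Fin n → X) → Y} (hsol : A.Solves uid 𝒢 f) (hG : G ∈ 𝒢) {K : ℕ}
    (hrep : L.Repetitive uid x K) {x' : Fin n → X} (hf : f x ≠ f x') {p₀ : ℤ}
    (hx : ∀ p : ℤ, |p - p₀| ≤ K → x (L.node p) = x' (L.node p)) :
    ∃ α : A.FairExecution uid G x,
      ∑ j ∈ Finset.range K, (n : ℝ) / (16 * ((j : ℝ) + 1)) ≤ α.messages f := by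
  classical
  obtain ⟨ch⟩ := hA.exists_equivariantChoice
  obtain ⟨kind, hkind⟩ := exists_recurrent_sequence
  have hn : 0 < n := by have := L.three_le; omega
  set α := phaseExecution ch uid G kind hkind (fun _ => Set.univ) 0 (fun _ _ => rfl) hn x with hα
  refine ⟨α, ?_⟩
  have hT : sInf (α.completed f) ∈ α.completed f := Nat.sInf_mem (hsol G hG x α)
  set τ := sInf (α.completed f) with hτ
  set t := τ / n with ht
  have hsent : ((phase ch uid G kind (fun _ => Set.univ) x t).sent : ℝ) ≤ α.messages f := by
    exact_mod_cast sent_phase_le_phaseExecution ch uid G kind hkind _ 0 (fun _ _ => rfl) hn x τ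
  refine le_trans ?_ ((sum_le_sent_phase (L := L) hA hrep t).trans hsent)
  by_cases hcount : K ≤ activeCount L uid ch kind x t
  · rw [min_eq_left hcount]
  exfalso
  -- Completion may fall inside phase `t`. Messages are counted only up to the start of that phase,
  -- but the stopped state is inspected at its end, which may cost one more active phase.
  have hcount' : activeCount L uid ch kind x (t + 1) ≤ K :=
    (activeCount_succ_le t).trans (by omega)
  have hdone : A.decision (phase ch uid G kind (fun _ => Set.univ) x (t + 1)) (L.node p₀) =
      some (f x) := by
    rw [← phaseExecution_config_mul ch uid G kind hkind _ 0 (fun _ _ => rfl) hn x]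
    exact α.decision_of_le (Nat.lt_mul_div_succ τ hn).le (hT _)
  -- Up to the end of phase `t` only nodes that the differing values cannot yet have influenced take
  -- part; afterwards all do, which makes the execution fair.
  let S : ℕ → Set (Fin n) := fun s => if s < t + 1 then
    {i | ∃ p : ℤ, |p - p₀| + activeCount L uid ch kind x s ≤ K ∧ L.node p = i} else Set.univ
  have hrel := localRel_eq_phase (S := S) hA hx (ch := ch) (kind := kind) (T := t + 1)
    (fun s hs => if_pos hs)
    (t + 1) le_rfl p₀ (by simpa using hcount')
  let β := phaseExecution ch uid G kind hkind S (t + 1) (fun s hs => by simp [S]; omega) hn x'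
  have hdone' : A.decision (β.config (n * (t + 1))) (L.node p₀) = some (f x) := by
    have hmem : (phase ch uid G kind (fun _ => Set.univ) x (t + 1)).mem (L.node p₀) =
      (phase ch uid G kind S x' (t + 1)).mem (L.node p₀) := by
      simpa using hrel.mem
    rw [phaseExecution_config_mul, ← hdone, decision, decision, hrel.ctrl, hmem]
  obtain ⟨s, hs⟩ := hsol G hG x' β
  have h1 := β.decision_of_le (le_max_left (n * (t + 1)) s) hdone'
  have h2 := β.decision_of_le (le_max_right (n * (t + 1)) s) (hs (L.node p₀))
  rw [h1] at h2
  exact hf (Option.some.inj h2)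

end Algorithm

/-! ### Repetitive rings of any size -/

theorem Int.emod_eq_emod_iff_dvd_sub' {n a b : ℤ} : a % n = b % n ↔ n ∣ a - b := by
  rw [Int.emod_eq_emod_iff_emod_sub_eq_zero, Int.dvd_iff_emod_eq_zero]

/-- This is the irrationality of √2. -/
theorem Int.sq_ne_two_mul_sq {i : ℤ} (hi : 1 ≤ i) (z : ℤ) : z ^ 2 ≠ 2 * i ^ 2 := by
  intro h
  refine irrational_sqrt_two ⟨|z| / i, ?_⟩
  have hi' : (0 : ℝ) < i := by exact_mod_cast hi
  have h' : (z : ℝ) ^ 2 = 2 * (i : ℝ) ^ 2 := by exact_mod_cast h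
  symm
  rw [Real.sqrt_eq_iff_mul_self_eq (by norm_num) (by push_cast; positivity)]
  push_cast
  field_simp
  rw [sq_abs]
  linarith

/-- Every `n` is the denominator of a fraction that is badly approximable by fractions with
denominators up to a multiple of `√n`. -/
theorem exists_badly_approximable {n : ℕ} (hn : 0 < n) : ∃ a : ℕ, ∀ i : ℤ, 1 ≤ i → 8 * i ^ 2 ≤ n →
    ∀ z : ℤ, n ≤ 8 * i * |a * i - n * z| := by
  -- The numerator is the integer part of √2 n.
  refine ⟨Nat.sqrt (2 * n ^ 2), fun i hi hin z => ?_⟩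
  have h1 : ((Nat.sqrt (2 * n ^ 2) : ℕ) : ℤ) ^ 2 ≤ 2 * (n : ℤ) ^ 2 := by
    exact_mod_cast Nat.sqrt_le' (2 * n ^ 2)
  have h2 : 2 * (n : ℤ) ^ 2 < (((Nat.sqrt (2 * n ^ 2) : ℕ) : ℤ) + 1) ^ 2 := by
    exact_mod_cast Nat.lt_succ_sqrt' (2 * n ^ 2)
  have ha0 : 0 ≤ ((Nat.sqrt (2 * n ^ 2) : ℕ) : ℤ) := by positivity
  generalize ((Nat.sqrt (2 * n ^ 2) : ℕ) : ℤ) = a at h1 h2 ha0 ⊢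
  have hN : 0 < (n : ℤ) := by exact_mod_cast hn
  generalize (n : ℤ) = N at h1 h2 hin hN ⊢
  by_contra! hlt
  set D := a * i - N * z with hD
  have ha : 2 * a ≤ 3 * N := by
    by_contra! h
    nlinarith
  have h3 : 2 * N ^ 2 - a ^ 2 ≤ 3 * N := by nlinarith
  have habs : 0 ≤ |D| := abs_nonneg D
  have hDD : D ^ 2 = |D| ^ 2 := (sq_abs D).symm
  have e1 : i ^ 2 * (2 * N ^ 2 - a ^ 2) ≤ i ^ 2 * (3 * N) :=
    mul_le_mul_of_nonneg_left h3 (sq_nonneg i)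
  have e1' : 8 * (i ^ 2 * N) ≤ N ^ 2 := by nlinarith
  have e1'' : 0 ≤ i ^ 2 * (2 * N ^ 2 - a ^ 2) := mul_nonneg (sq_nonneg i) (by linarith)
  have e2 : |2 * a * i * D| ≤ 3 * N * (i * |D|) := by
    rw [abs_mul, abs_of_nonneg (by positivity : 0 ≤ 2 * a * i)]
    have : 0 ≤ i * |D| := by positivity
    nlinarith
  have e2' : 8 * (N * (i * |D|)) < N ^ 2 := by nlinarith
  have e3 : 64 * |D| ^ 2 < N ^ 2 := by
    have : 8 * |D| < N := by nlinarith
    nlinarith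
  have e4 := abs_le.1 e2
  -- The left side is a non-zero multiple of `N ^ 2`. On the right, the three terms are bounded in
  -- absolute value by 3/8, 3/8 and 1/64 of `N ^ 2`, and only the last enters negatively by sign;
  -- this is a contradiction.
  have key : N ^ 2 * (2 * i ^ 2 - z ^ 2) =
      i ^ 2 * (2 * N ^ 2 - a ^ 2) + 2 * a * i * D - D ^ 2 := by
    rw [hD]; ring
  have hne : 2 * i ^ 2 - z ^ 2 ≠ 0 := fun h => Int.sq_ne_two_mul_sq hi z (by linarith)
  have hN2 : 0 < N ^ 2 := by positivity
  rcases lt_or_gt_of_ne hne with h | h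
  · have : N ^ 2 * (2 * i ^ 2 - z ^ 2) ≤ -N ^ 2 := by nlinarith
    linarith [e4.1]
  · have : N ^ 2 ≤ N ^ 2 * (2 * i ^ 2 - z ^ 2) := by nlinarith
    linarith [e4.2, sq_nonneg D]

/-- Dividing by the gcd divides both sides of the estimate by `d`. Coprimality makes `a` invertible
modulo `m`, so that every key is attained. -/
theorem exists_coprime_badly_approximable {n : ℕ} (hn : 0 < n) : ∃ a m d : ℕ, n = d * m ∧
    a.Coprime m ∧ ∀ i : ℤ, 1 ≤ i → 8 * i ^ 2 ≤ n → ∀ z : ℤ, m ≤ 8 * i * |a * i - m * z| := by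
  obtain ⟨b, hb⟩ := exists_badly_approximable hn
  have hd : 0 < Nat.gcd b n := Nat.gcd_pos_of_pos_right _ hn
  refine ⟨b / Nat.gcd b n, n / Nat.gcd b n, Nat.gcd b n,
    (Nat.mul_div_cancel' (Nat.gcd_dvd_right _ _)).symm, Nat.coprime_div_gcd_div_gcd hd,
    fun i hi hin z => ?_⟩
  have h := hb i hi hin z
  have h1 : (b : ℤ) = Nat.gcd b n * (b / Nat.gcd b n : ℕ) := by
    exact_mod_cast (Nat.mul_div_cancel' (Nat.gcd_dvd_left b n)).symm
  have h2 : (n : ℤ) = Nat.gcd b n * (n / Nat.gcd b n : ℕ) := by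
    exact_mod_cast (Nat.mul_div_cancel' (Nat.gcd_dvd_right b n)).symm
  generalize ((b / Nat.gcd b n : ℕ) : ℤ) = a at *
  generalize ((n / Nat.gcd b n : ℕ) : ℤ) = m at *
  have hd' : 0 < (Nat.gcd b n : ℤ) := by exact_mod_cast hd
  generalize (Nat.gcd b n : ℤ) = d at *
  rw [h1, h2, show d * a * i - d * m * z = d * (a * i - m * z) by ring, abs_mul,
    abs_of_pos hd'] at h
  nlinarith

/-- For every periodic function `κ` there is a ring on which the UIDs are ordered according
to `κ`. -/
theorem exists_cyclicLayout {n : ℕ} (hn : 3 ≤ n) {U : Type u₁} [LinearOrder U] (uid : Fin n ↪ U)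
    {κ : ℤ → ℤ} (hκ : ∀ p q, (n : ℤ) ∣ p - q → κ p = κ q) :
    ∃ (G : SimpleGraph (Fin n)) (L : CyclicLayout G) (σ : Equiv.Perm (Fin n)) (ρ : ℤ → Fin n),
      G ∈ sparseGraphs n ∧ StrictMono (uid ∘ σ) ∧ (∀ p, L.node p = σ (ρ p)) ∧
      ∀ p q, κ p < κ q → ρ p < ρ q := by
  have hn0 : (0 : ℤ) < n := by omega
  let pos : ℤ → Fin n := fun p => ⟨(p % n).toNat, by
    have := Int.emod_lt_of_pos p hn0
    have := Int.emod_nonneg p hn0.ne'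
    omega⟩
  have hpos : ∀ p, (((pos p : Fin n) : ℕ) : ℤ) = p % n := fun p =>
    Int.toNat_of_nonneg (Int.emod_nonneg p hn0.ne')
  have hpos_iff : ∀ p q, pos p = pos q ↔ (n : ℤ) ∣ p - q := by
    intro p q
    rw [Fin.ext_iff, ← Nat.cast_inj (R := ℤ), hpos, hpos, ← Int.emod_eq_emod_iff_dvd_sub']
  -- `s` sorts the positions by `κ` and `σ` sorts the nodes by UID. Position `p` thus has rank `ρ p`
  -- and receives the node whose UID has that rank.
  let s := Tuple.sort fun i : Fin n => κ i
  let σ := Tuple.sort uid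
  let ρ : ℤ → Fin n := fun p => s.symm (pos p)
  let node : ℤ → Fin n := fun p => σ (ρ p)
  have hnode : ∀ p q, node p = node q ↔ (n : ℤ) ∣ p - q := fun p q => by
    simp only [node, ρ, EmbeddingLike.apply_eq_iff_eq, hpos_iff]
  have hsurj : Function.Surjective node := by
    intro i
    refine ⟨((s (σ.symm i) : Fin n) : ℕ), ?_⟩
    have : pos ((s (σ.symm i) : Fin n) : ℕ) = s (σ.symm i) := by
      rw [Fin.ext_iff, ← Nat.cast_inj (R := ℤ), hpos]
      exact Int.emod_eq_of_lt (by positivity) (by exact_mod_cast (s (σ.symm i)).2)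
    simp [node, ρ, this]
  have hne : ∀ p, node p ≠ node (p + 1) := by
    intro p h
    rw [hnode, show p - (p + 1) = -1 by ring, dvd_neg] at h
    have := Int.le_of_dvd one_pos h
    omega
  have hadd : ∀ p q (e : ℤ), node p = node q → node (p + e) = node (q + e) := by
    intro p q e h
    rw [hnode] at h ⊢
    rwa [show p + e - (q + e) = p - q by ring]
  let G := SimpleGraph.fromRel fun i j => ∃ p, i = node p ∧ j = node (p + 1)
  have hadj : ∀ p, G.Adj (node p) (node (p + 1)) := fun p =>
    (SimpleGraph.fromRel_adj _ _ _).2 ⟨hne p, .inl ⟨p, rfl, rfl⟩⟩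
  let L : CyclicLayout G := ⟨hn, node, hnode, hsurj, fun p j => by
    constructor
    · intro h
      rcases ((SimpleGraph.fromRel_adj _ _ _).1 h).2 with ⟨q, h1, h2⟩ | ⟨q, h1, h2⟩
      · left; rw [h2]; exact (hadd _ _ 1 h1).symm
      · right
        rw [h1]
        have := hadd _ _ (-1) h2
        rw [add_neg_cancel_right, ← sub_eq_add_neg] at this
        exact this.symm
    · rintro (rfl | rfl)
      · exact hadj p
      · have := hadj (p - 1)
        rw [sub_add_cancel] at this
        exact this.symm⟩
  refine ⟨G, L, σ, ρ, ⟨?_, ?_⟩, ?_, fun _ => rfl, ?_⟩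
  · have : Nonempty (Fin n) := ⟨node 0⟩
    have hreach : ∀ p : ℤ, G.Reachable (node 0) (node p) := by
      intro p
      induction p using Int.induction_on with
      | zero => exact .rfl
      | succ i ih => exact ih.trans (hadj _).reachable
      | pred i ih =>
        refine ih.trans (SimpleGraph.Adj.reachable ?_)
        have := hadj (-i - 1)
        rw [sub_add_cancel] at this
        exact this.symm
    refine ⟨fun i j => ?_⟩
    obtain ⟨p, rfl⟩ := hsurj i
    obtain ⟨q, rfl⟩ := hsurj j
    exact (hreach p).symm.trans (hreach q)
  · have hcard : G.edgeSet.ncard ≤ n := by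
      -- Each edge joins some node to its successor, so there are at most `n` of them.
      let g : Fin n → Sym2 (Fin n) := fun i => s(i, node (Function.surjInv hsurj i + 1))
      have hg : ∀ p, s(node p, node (p + 1)) ∈ g '' Set.univ := by
        intro p
        refine ⟨node p, trivial, ?_⟩
        simp only [g]
        rw [hadd _ p 1 (Function.surjInv_eq hsurj _)]
      have hsub : G.edgeSet ⊆ g '' Set.univ := by
        intro e
        induction e using Sym2.ind with
        | _ i j =>
          intro h
          rcases ((SimpleGraph.fromRel_adj _ _ _).1 (G.mem_edgeSet.1 h)).2 with ⟨q, rfl, rfl⟩ | ⟨q, rfl, rfl⟩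
          · exact hg q
          · rw [Sym2.eq_swap]; exact hg q
      calc G.edgeSet.ncard ≤ (g '' Set.univ).ncard := Set.ncard_le_ncard hsub
        _ ≤ (Set.univ : Set (Fin n)).ncard := Set.ncard_image_le
        _ = n := by simp [Set.ncard_univ]
    have hn3 : (3 : ℝ) ≤ n := by exact_mod_cast hn
    have hlog : 1 < Real.log n := by
      rw [Real.lt_log_iff_exp_lt (by linarith)]
      linarith [Real.exp_one_lt_d9]
    have : (G.edgeSet.ncard : ℝ) ≤ n := by exact_mod_cast hcard
    nlinarith
  · exact (Tuple.monotone_sort uid).strictMono_of_injective (uid.injective.comp σ.injective)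
  · intro p q hlt
    by_contra! hle
    have := Tuple.monotone_sort (fun i : Fin n => κ i) hle
    simp only [Function.comp_apply, ρ, s, Equiv.apply_symm_apply, hpos] at this
    have hper : ∀ p, κ (p % n) = κ p := fun p => hκ _ _ (by
      rw [← Int.emod_eq_emod_iff_dvd_sub', Int.emod_emod])
    rw [hper, hper] at this
    exact absurd hlt (not_lt.2 this)

/-! ### Copies of windows on rings ordered by a p mod m -/

namespace CyclicLayout

variable {n : ℕ} {G : SimpleGraph (Fin n)} {L : CyclicLayout G} {U : Type u₁} [LinearOrder U]
  {uid : Fin n ↪ U} {X : Type u₂} [LinearOrder X] {x : Fin n → X}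

/-- The UIDs and values on the ring are ordered according to `κ`, where values may agree if `κ`
differs by one only; or all values are the same. -/
structure OrderedBy (L : CyclicLayout G) (uid : Fin n ↪ U) (x : Fin n → X) (κ : ℤ → ℤ) : Prop where
  uid : ∀ p q, κ p < κ q → uid (L.node p) < uid (L.node q)
  value : (∀ p q, κ p + 2 ≤ κ q → x (L.node p) < x (L.node q)) ∨ ∀ i j, x i = x j

/-- A common shift keeps all differences of keys, and a gap of 2 lets the keys alone decide every
comparison, even of values, for which a gap of 1 would leave ties open. -/
theorem OrderedBy.windowEquiv {κ : ℤ → ℤ} (h : L.OrderedBy uid x κ) {w : ℕ} {p q s : ℤ}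
    (hgap : ∀ i j : ℤ, |i| ≤ w → |j| ≤ w → i ≠ j → 2 ≤ |κ (p + i) - κ (p + j)|)
    (hs : ∀ i : ℤ, |i| ≤ w → κ (q + i) = κ (p + i) + s) : L.WindowEquiv uid x w p q := by
  have key : ∀ i j : ℤ, |i| ≤ w → |j| ≤ w → κ (p + i) + 2 ≤ κ (p + j) →
      κ (q + i) + 2 ≤ κ (q + j) := by
    intro i j hi hj hij
    rw [hs i hi, hs j hj]
    linarith
  intro i j hi hj
  by_cases hij : i = j
  · subst hij; simp
  have huid : ∀ p i j, κ (p + i) + 2 ≤ κ (p + j) →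
    uid (L.node (p + i)) < uid (L.node (p + j)) := fun p i j hle => h.uid _ _ (by linarith)
  have hx : (∀ i j, x i = x j) ∨ ∀ p i j, κ (p + i) + 2 ≤ κ (p + j) →
      x (L.node (p + i)) < x (L.node (p + j)) := by
    rcases h.value with h | h
    · exact .inr fun p i j hle => h _ _ hle
    · exact .inl h
  rcases le_abs.1 (hgap i j hi hj hij) with hle | hle
  · have h1 : κ (p + j) + 2 ≤ κ (p + i) := by linarith
    have h2 := key j i hj hi h1
    refine ⟨iff_of_false (huid _ _ _ h1).not_gt (huid _ _ _ h2).not_gt, ?_⟩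
    rcases hx with hx | hx
    · simp [hx (L.node (p + i)) (L.node (p + j)), hx (L.node (q + i)) (L.node (q + j))]
    · exact iff_of_false (hx _ _ _ h1).not_gt (hx _ _ _ h2).not_gt
  · have h1 : κ (p + i) + 2 ≤ κ (p + j) := by linarith
    have h2 := key i j hi hj h1
    refine ⟨iff_of_true (huid _ _ _ h1) (huid _ _ _ h2), ?_⟩
    rcases hx with hx | hx
    · simp [hx (L.node (p + i)) (L.node (p + j)), hx (L.node (q + i)) (L.node (q + j))]
    · exact iff_of_true (hx _ _ _ h1) (hx _ _ _ h2)

theorem OrderedBy.repetitive {a m d : ℕ} (hm : 0 < m) (hdm : n = d * m) (ham : a.Coprime m)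
    (happ : ∀ i : ℤ, 1 ≤ i → 8 * i ^ 2 ≤ n → ∀ z : ℤ, m ≤ 8 * i * |a * i - m * z|)
    (h : L.OrderedBy uid x fun p => a * p % m) {K : ℕ} (hK : 2048 * K ^ 2 ≤ n) :
    L.Repetitive uid x K := by
  intro w hw hwK p
  have hm0 : (0 : ℤ) < m := by exact_mod_cast hm
  set κ : ℤ → ℤ := fun p => a * p % m with hκ
  have hwn : 2048 * (w : ℤ) ^ 2 ≤ n := by
    have : 2048 * w ^ 2 ≤ n := (Nat.mul_le_mul_left _ (Nat.pow_le_pow_left hwK 2)).trans hK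
    exact_mod_cast this
  have hw1 : (1 : ℤ) ≤ w := by exact_mod_cast hw
  -- If `8 * m ^ 2 ≤ n`, then `i = m`, `z = a` would violate the approximation bound. The factor
  -- 2048 is 8 · 16², so that the estimates below give gaps larger than 1.
  have hmw : 16 * (w : ℤ) < m := by
    have : (n : ℤ) < 8 * (m : ℤ) ^ 2 := by
      by_contra! hle
      have := happ m (by omega) hle a
      rw [mul_comm (a : ℤ), sub_self, abs_zero] at this
      omega
    by_contra! hle
    nlinarith
  have hnonneg : ∀ q, 0 ≤ κ q := fun q => Int.emod_nonneg _ hm0.ne'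
  have hlt : ∀ q, κ q < m := fun q => Int.emod_lt_of_pos _ hm0
  -- Two positions of a window differ by at most `2 * w`, whence 8 becomes 16.
  have happ' : ∀ i j : ℤ, |i| ≤ w → |j| ≤ w → i ≠ j → ∀ z : ℤ,
      (m : ℤ) ≤ 16 * w * |a * (i - j) - m * z| := by
    have key : ∀ e : ℤ, 1 ≤ e → e ≤ 2 * w → ∀ z : ℤ, (m : ℤ) ≤ 16 * w * |a * e - m * z| := by
      intro e he hew z
      refine (happ e he (by nlinarith) z).trans ?_
      exact mul_le_mul_of_nonneg_right (by linarith) (abs_nonneg _)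
    intro i j hi hj hij z
    rw [abs_le] at hi hj
    rcases lt_or_gt_of_ne hij with hlt | hlt
    · have := key (j - i) (by omega) (by linarith) (-z)
      rwa [← abs_neg, show -(a * (j - i) - m * -z) = a * (i - j) - m * z by ring] at this
    · exact key (i - j) (by omega) (by linarith) z
  have hdiff : ∀ i j : ℤ, ∃ z : ℤ, κ (p + i) - κ (p + j) = a * (i - j) - m * z := by
    intro i j
    refine ⟨a * (p + i) / m - a * (p + j) / m, ?_⟩
    simp only [hκ, Int.emod_def]
    ring
  have hgap : ∀ i j : ℤ, |i| ≤ w → |j| ≤ w → i ≠ j → 2 ≤ |κ (p + i) - κ (p + j)| := by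
    intro i j hi hj hij
    obtain ⟨z, hz⟩ := hdiff i j
    have := happ' i j hi hj hij z
    rw [hz]
    by_contra! hlt
    nlinarith
  obtain ⟨i₁, hi₁, hmax⟩ := Finset.exists_max_image (Finset.Icc (-w : ℤ) w) (fun i => κ (p + i))
    ⟨0, by simp⟩
  obtain ⟨i₀, hi₀, hmin⟩ := Finset.exists_min_image (Finset.Icc (-w : ℤ) w) (fun i => κ (p + i))
    ⟨0, by simp⟩
  simp only [Finset.mem_Icc, ← abs_le] at hi₁ hi₀ hmax hmin
  have hne : i₁ ≠ i₀ := by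
    rintro rfl
    have h1 := hmax 1 (by simpa using hw1)
    have h2 := hmin 1 (by simpa using hw1)
    have := hgap i₁ 1 hi₁ (by simpa using hw1)
    by_cases h : i₁ = 1
    · have h1 := hmax 0 (by simp)
      have h2 := hmin 0 (by simp)
      have := hgap i₁ 0 hi₁ (by simp) (by omega)
      rw [le_antisymm h1 h2] at this
      simp at this
    · have := this h
      rw [le_antisymm h1 h2] at this
      simp at this
  -- From `lo` to `hi` run the keys that the centre of a copy may have without any key of the window
  -- leaving the range from 0 to `m - 1`.
  set lo := κ p - κ (p + i₀) with hlo
  set hi := κ p + (m - 1 - κ (p + i₁)) with hhi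
  -- The number of admissible keys is `m` minus the spread of the window, which is the distance of a
  -- multiple of `a` from a multiple of `m`.
  have hcardI : (m : ℤ) ≤ 16 * w * (hi + 1 - lo) := by
    obtain ⟨z, hz⟩ := hdiff i₁ i₀
    have := happ' i₁ i₀ hi₁ hi₀ hne (z + 1)
    rw [show (a * (i₁ - i₀) - m * (z + 1) : ℤ) = κ (p + i₁) - κ (p + i₀) - m by rw [hz]; ring,
      abs_sub_comm, abs_of_nonneg (by linarith [hlt (p + i₁), hnonneg (p + i₀)])] at this
    rw [hhi, hlo]
    linarith
  have h0 := hmin 0 (by simp)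
  have h0' := hmax 0 (by simp)
  rw [add_zero] at h0 h0'
  obtain ⟨u, hu⟩ : ∃ u : ℤ, (m : ℤ) ∣ a * u - 1 := by
    have := (Int.isCoprime_iff_gcd_eq_one.2 (by simpa using ham) : IsCoprime (a : ℤ) m)
    obtain ⟨u, v, huv⟩ := this
    exact ⟨u, -v, by linarith⟩
  have hκu : ∀ v e : ℤ, 0 ≤ v → v < m → κ (u * v + m * e) = v := by
    intro v e hv hv'
    obtain ⟨y, hy⟩ := hu
    simp only [hκ]
    rw [show (a * (u * v + m * e) : ℤ) = v + m * (y * v + a * e) by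
      linear_combination v * hy, Int.add_mul_emod_self_left, Int.emod_eq_of_lt hv hv']
  -- With `u` inverse to `a`, each admissible key `v` is attained at `u * v` and its translates by
  -- multiples of `m`, which are `d` positions modulo `n`.
  let F : ℤ × ℕ → Fin n := fun z => L.node (u * z.1 + m * z.2)
  have hsub : F '' ((Finset.Icc lo hi ×ˢ Finset.range d : Finset (ℤ × ℕ)) : Set (ℤ × ℕ)) ⊆
      {i | ∃ q, L.node q = i ∧ L.WindowEquiv uid x w p q} := by
    rintro _ ⟨⟨v, e⟩, hve, rfl⟩
    simp only [Finset.coe_product, Set.mem_prod, Finset.coe_Icc, Set.mem_Icc] at hve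
    have hv : κ (u * v + m * e) = v :=
      hκu v e (by linarith [hve.1.1]) (by linarith [hve.1.2])
    refine ⟨_, rfl, h.windowEquiv (s := v - κ p) hgap fun i hi => ?_⟩
    have h1 := hmin i hi
    have h2 := hmax i hi
    show κ (u * v + m * e + i) = κ (p + i) + (v - κ p)
    generalize u * v + (m : ℤ) * e = q at hv ⊢
    rw [← Int.emod_eq_of_lt (a := κ (p + i) + (v - κ p)) (b := m) (by linarith [hve.1.1])
      (by linarith [hve.1.2])]
    refine Int.emod_eq_emod_iff_dvd_sub'.2 ?_
    rw [← hv]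
    simp only [hκ, Int.emod_def]
    exact ⟨a * (p + i) / m + a * q / m - a * p / m, by ring⟩
  have hinj : Set.InjOn F ((Finset.Icc lo hi ×ˢ Finset.range d : Finset (ℤ × ℕ)) :
      Set (ℤ × ℕ)) := by
    rintro ⟨v, e⟩ hve ⟨v', e'⟩ hve' heq
    simp only [Finset.coe_product, Set.mem_prod, Finset.coe_Icc, Set.mem_Icc, Finset.coe_range,
      Set.mem_Iio] at hve hve'
    have hdvd := (L.node_eq_iff _ _).1 heq
    simp only at hdvd
    have hvv : v = v' := by
      have h1 := hκu v e (by linarith [hve.1.1]) (by linarith [hve.1.2])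
      have h2 := hκu v' e' (by linarith [hve'.1.1]) (by linarith [hve'.1.2])
      rw [← h1, ← h2]
      refine Int.emod_eq_emod_iff_dvd_sub'.2 ?_
      rw [← mul_sub]
      refine Dvd.dvd.mul_left (Dvd.dvd.trans ?_ hdvd) _
      rw [hdm]
      push_cast
      exact dvd_mul_left _ _
    subst hvv
    have hee : (d : ℤ) ∣ e - e' := by
      rw [show u * v + m * e - (u * v + m * e') = (e - e') * (m : ℤ) by ring, hdm] at hdvd
      push_cast at hdvd
      exact Int.dvd_of_mul_dvd_mul_right hm0.ne' hdvd
    have := Int.eq_zero_of_abs_lt_dvd hee (by rw [abs_lt]; omega)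
    rw [Prod.mk.injEq]
    exact ⟨rfl, by omega⟩
  have hcard := Set.ncard_le_ncard hsub
  rw [hinj.ncard_image, Set.ncard_coe_finset, Finset.card_product, Int.card_Icc,
    Finset.card_range] at hcard
  have h1 : m ≤ 16 * w * (hi + 1 - lo).toNat := by
    zify
    rw [Int.toNat_of_nonneg (by linarith [hlt (p + i₁), hnonneg (p + i₀)])]
    exact hcardI
  calc n = d * m := hdm
    _ ≤ d * (16 * w * (hi + 1 - lo).toNat) := Nat.mul_le_mul_left _ h1
    _ = 16 * w * ((hi + 1 - lo).toNat * d) := by ring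
    _ ≤ _ := Nat.mul_le_mul_left _ hcard

end CyclicLayout

/-! ### The lower bound -/

/-- A locally-sensitive or extractive function has an input on a suitable ring such that windows
have many copies, while the result is not determined by the values near some node. -/
theorem exists_repetitive_input {n K : ℕ} (hn : 3 ≤ n) (hK : 2048 * K ^ 2 ≤ n) (hK1 : 1 ≤ K)
    {U : Type u₁} [LinearOrder U]
    {X : Type u₂} [LinearOrder X] [Nonempty X] {Y : Type u₃} (uid : Fin n ↪ U)
    {f : (Fin n → X) → Y} (hf : IsLocallySensitive f ∨ IsExtractive f) :
    ∃ (G : SimpleGraph (Fin n)) (L : CyclicLayout G) (x x' : Fin n → X) (p₀ : ℤ),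
      G ∈ sparseGraphs n ∧ L.Repetitive uid x K ∧ f x ≠ f x' ∧
        ∀ p : ℤ, |p - p₀| ≤ K → x (L.node p) = x' (L.node p) := by
  classical
  have hn0 : 0 < n := by omega
  obtain ⟨a, m, d, hdm, ham, happ⟩ := exists_coprime_badly_approximable hn0
  have hm : 0 < m := Nat.pos_of_ne_zero (by rintro rfl; simp at hdm; omega)
  have hm0 : (0 : ℤ) < m := by exact_mod_cast hm
  have hper : ∀ p q : ℤ, (n : ℤ) ∣ p - q → (a * p % m : ℤ) = a * q % m := by
    intro p q hpq
    rw [Int.emod_eq_emod_iff_dvd_sub', ← mul_sub]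
    refine Dvd.dvd.mul_left (Dvd.dvd.trans ?_ hpq) _
    rw [hdm]
    push_cast
    exact dvd_mul_left _ _
  obtain ⟨G, L, σ, ρ, hG, hσ, hnode, hρ⟩ := exists_cyclicLayout hn uid hper
  have huid : ∀ p q : ℤ, (a * p % m : ℤ) < a * q % m → uid (L.node p) < uid (L.node q) := by
    intro p q hpq
    rw [hnode, hnode]
    exact hσ (hρ p q hpq)
  have hKn : 4 * (K : ℤ) + 4 ≤ n := by
    have : 4 * K + 4 ≤ n := by nlinarith
    exact_mod_cast this
  have hnode_ne : ∀ p q : ℤ, p < q → q < p + n → L.node p ≠ L.node q := by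
    intro p q h1 h2 h
    rw [L.node_eq_iff] at h
    have := Int.eq_zero_of_abs_lt_dvd h (by rw [abs_lt]; constructor <;> linarith)
    omega
  rcases hf with ⟨-, hsens⟩ | ⟨hcons, e, he⟩
  · obtain ⟨x, -, hx⟩ := hsens σ
    have hord : L.OrderedBy uid x fun p => a * p % m := by
      refine ⟨huid, .inl fun p q hpq => ?_⟩
      -- A position of key strictly in between exists because `a` is invertible. Sensitivity at its
      -- node yields two different values between those at `p` and `q`, which must then differ.
      obtain ⟨r, hr⟩ : ∃ r : ℤ, (a * r % m : ℤ) = a * p % m + 1 := by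
        obtain ⟨u, v, huv⟩ :=
          (Int.isCoprime_iff_gcd_eq_one.2 (by simpa using ham) : IsCoprime (a : ℤ) m)
        have h1 := Int.emod_nonneg (a * p) hm0.ne'
        have h2 := Int.emod_lt_of_pos (a * q) hm0
        refine ⟨u * (a * p % m + 1), Eq.trans ?_
          (Int.emod_eq_of_lt (a := a * p % m + 1) (b := m) (by linarith) (by linarith))⟩
        generalize (a * p % m : ℤ) + 1 = y
        rw [Int.emod_eq_emod_iff_dvd_sub']
        exact ⟨-v * y, by linear_combination y * huv⟩
      obtain ⟨b, c, hbc, h1, h2, -⟩ := hx (ρ r)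
      have hpr := h2 _ (hρ p r (by linarith))
      have hrq := h1 _ (hρ r q (by linarith))
      rw [hnode, hnode]
      rcases lt_or_gt_of_ne hbc with h | h
      · exact hpr.1.trans_lt (h.trans_le hrq.2)
      · exact hpr.2.trans_lt (h.trans_le hrq.1)
    obtain ⟨y, hy⟩ : ∃ y, f x ≠ f (Function.update x (L.node 0) y) := by
      obtain ⟨b, c, -, -, -, hbc⟩ := hx (ρ 0)
      rw [← hnode] at hbc
      by_cases h : f x = f (Function.update x (L.node 0) b)
      · exact ⟨c, fun h' => hbc (h.symm.trans h')⟩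
      · exact ⟨b, h⟩
    -- The window of radius `K` about position `K + 1` just misses the changed position 0.
    refine ⟨G, L, x, _, K + 1, hG, hord.repetitive hm hdm ham happ hK, hy, fun p hp => ?_⟩
    rw [abs_le] at hp
    rw [Function.update_of_ne]
    exact (hnode_ne 0 p (by linarith) (by linarith)).symm
  · have hconst : ∀ b : X, L.Repetitive uid (fun _ => b) K := fun b =>
      CyclicLayout.OrderedBy.repetitive hm hdm ham happ ⟨huid, .inr fun _ _ => rfl⟩ hK
    have hfconst : ∀ b : X, f (fun _ => b) = e b := fun b => (he fun _ => b).elim fun _ h => h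
    obtain ⟨b, c, hbc⟩ := hcons (fun _ => Classical.arbitrary X) ⟨0, hn0⟩
    have hbc : b ≠ c := fun h => hbc (by rw [h])
    -- `z` equals `b` on an arc of `2 * K + 1` nodes and `c` on the rest, which contains another
    -- such arc. Its result differs from that of one of the two constants, and `z` agrees with that
    -- constant on a window of radius `K`.
    let z : Fin n → X := fun i => if ∃ p : ℤ, 0 ≤ p ∧ p ≤ 2 * K ∧ L.node p = i then b else c
    by_cases h : f z = e b
    · refine ⟨G, L, fun _ => c, z, 3 * K + 1, hG, hconst c, ?_, fun p hp => ?_⟩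
      · rw [h, hfconst]
        exact fun h => hbc (e.injective h).symm
      · rw [abs_le] at hp
        refine (if_neg ?_).symm
        rintro ⟨q, hq0, hq1, hq⟩
        exact hnode_ne q p (by linarith) (by linarith) hq
    · refine ⟨G, L, fun _ => b, z, K, hG, hconst b, ?_, fun p hp => ?_⟩
      · rw [hfconst]
        exact fun h' => h h'.symm
      · rw [abs_le] at hp
        exact (if_pos ⟨p, by linarith, by linarith, rfl⟩).symm

/-- The harmonic sum is at least log (K + 1), hence at least a quarter of log n; with the factor
1/16 this gives 1/64. -/
theorem sum_harmonic_ge {n K : ℕ} (hn : 0 < n) (hK : n ≤ (K + 1) ^ 4) :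
    1 / 64 * (n * Real.log n) ≤ ∑ j ∈ Finset.range K, (n : ℝ) / (16 * ((j : ℝ) + 1)) := by
  have h1 : Real.log n ≤ 4 * Real.log ((K + 1 : ℕ) : ℝ) := by
    have : Real.log (n : ℝ) ≤ Real.log (((K + 1 : ℕ) : ℝ) ^ 4) :=
      Real.log_le_log (by exact_mod_cast hn) (by exact_mod_cast hK)
    rwa [Real.log_pow] at this
  have h2 := log_add_one_le_harmonic K
  have h3 : ∑ j ∈ Finset.range K, (n : ℝ) / (16 * ((j : ℝ) + 1)) = n / 16 * (harmonic K : ℝ) := by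
    simp only [harmonic, Rat.cast_sum, Finset.mul_sum]
    refine Finset.sum_congr rfl fun j _ => ?_
    push_cast
    field_simp
  rw [h3]
  have h4 : (0 : ℝ) ≤ n := Nat.cast_nonneg n
  push_cast at h1 h2
  have h5 : Real.log n ≤ 4 * (harmonic K : ℝ) := by linarith
  nlinarith

theorem lemma1 :
    ∃ C : ℝ, 0 < C ∧ ∃ N : ℕ, ∀ n : ℕ, N ≤ n →
      ∀ (U : Type u₁) [LinearOrder U] (X : Type u₂) [LinearOrder X] [Nonempty X] (Y : Type u₃)
        (uid : Fin n ↪ U) (f : (Fin n → X) → Y),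
        IsLocallySensitive f ∨ IsExtractive f →
          ENNReal.ofReal (C * (n * Real.log n)) ≤
            (comparisonMessageComplexity.{u₁, u₂, u₃, v} uid f (sparseGraphs n) : ℝ≥0∞) := by
  -- For `n ≥ 2048 ^ 2` the choice K = ⌊√(n / 2048)⌋ satisfies (K + 1)² ≥ 2048, which gives `n ≤ (K
  -- + 1) ^ 4`.
  refine ⟨1 / 64, by norm_num, 2048 ^ 2, fun n hn U _ X _ _ Y uid f hf => ?_⟩
  norm_num at hn
  set K := Nat.sqrt (n / 2048) with hKdef
  have hK : 2048 * K ^ 2 ≤ n :=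
    (Nat.mul_le_mul_left _ (Nat.sqrt_le' _)).trans (Nat.mul_div_le _ _)
  have hK' : n / 2048 < (K + 1) ^ 2 := Nat.lt_succ_sqrt' _
  have hK1 : 1 ≤ K := Nat.le_sqrt'.2 (by omega)
  have hK4 : n ≤ (K + 1) ^ 4 := by
    have h1 : 2048 ≤ (K + 1) ^ 2 := by omega
    have h2 : n ≤ 2048 * (K + 1) ^ 2 := by omega
    calc n ≤ 2048 * (K + 1) ^ 2 := h2
      _ ≤ (K + 1) ^ 2 * (K + 1) ^ 2 := Nat.mul_le_mul_right _ h1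
      _ = _ := by ring
  obtain ⟨G, L, x, x', p₀, hG, hrep, hne, hx⟩ :=
    exists_repetitive_input (by omega) hK hK1 uid hf
  -- Message counts are integers, so the bound may be rounded up and proved in `ℕ∞`.
  have hle : ((⌈1 / 64 * (n * Real.log n)⌉₊ : ℕ) : ℕ∞) ≤
      comparisonMessageComplexity.{u₁, u₂, u₃, v} uid f (sparseGraphs n) := by
    refine le_iInf fun A => le_iInf fun hA => le_iInf fun hsol => ?_
    obtain ⟨α, hα⟩ := Algorithm.exists_sum_le_messages hA hsol hG hrep hne hx
    refine le_trans ?_ (le_iSup_of_le G <| le_iSup_of_le hG <| le_iSup_of_le x <|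
      le_iSup_of_le α le_rfl)
    exact_mod_cast Nat.ceil_le.2 ((sum_harmonic_ge (by omega) hK4).trans hα)
  calc ENNReal.ofReal (1 / 64 * (n * Real.log n))
      ≤ ENNReal.ofReal (⌈1 / 64 * (n * Real.log n)⌉₊ : ℕ) :=
        ENNReal.ofReal_le_ofReal (Nat.le_ceil _)
    _ = (((⌈1 / 64 * (n * Real.log n)⌉₊ : ℕ) : ℕ∞) : ℝ≥0∞) := by simp
    _ ≤ _ := by exact_mod_cast hle
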